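/- Setting. Let $\mu$ be a measure on a measurable space $\mathcal Y$, let $\Theta\subset\mathbb R^p$, $\alpha\ge 0$, and for each $i\ge 1$ let $f_i(\cdot,\theta)$, $\theta\in\Theta$, be a family of probability densities with respect to $\mu$. Let $Y_1,Y_2,\dots$ be independent random elements of $\mathcal Y$ such that $Y_i$ has density $f_i(\cdot,\theta^*)$ for a common true parameter $\theta^*\in\Theta$; $E_{\theta^*}$ denotes expectation when $Y$ has density $f_i(\cdot,\theta^*)$. Put $$V_i(y,\theta)=\frac{f_i(y,\theta)^{\alpha}}{\left(\int f_i(x,\theta)^{\alpha+1}\,d\mu(x)\right)^{\alpha/(\alpha+1)}}\quad(\alpha>0),\qquad V_i(y,\theta)=\log f_i(y,\theta)\quad(\alpha=0),$$ $$H_n^\alpha(\theta)=\frac1n\sum_{i=1}^n V_i(Y_i,\theta),\qquad J^{(i)}=\left(-E_{\theta^*}\left[\frac{\partial^2V_i(Y,\theta^*)}{\partial\theta_j\partial\theta_k}\right]\right)_{j,k=1,\dots,p},\qquad \Psi_n=\frac1n\sum_{i=1}^nJ^{(i)}.$$ Conditions. C1. The support $\mathcal X=\{y: f_i(y,\theta)>0\}$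 is the same for all $i$ and all $\theta\in\Theta$. C2. There is an open set $\Theta^*\subset\Theta$ containing $\theta^*$ such that, for every $i$ and almost all $y\in\mathcal X$, all partial derivatives of $f_i(y,\cdot)$ of order at most three exist on $\Theta^*$. C3. For every $i$ the integral $\int f_i(y,\theta)^{1+\alpha}\,d\mu(y)$ is finite and has all partial derivatives of order at most three in $\theta$ on $\Theta^*$, and these may be computed by differentiating under the integral sign. C4. The matrices $J^{(i)}$ are positive definite, and $\inf_{n\ge1}\lambda_{\min}(\Psi_n)>0$, where $\lambda_{\min}$ denotes the smallest eigenvalue. C5. There are functions $M^{(i)}_{jkl}$ with $\left|\partial^3V_i(y,\theta)/\partial\theta_j\partial\theta_k\partial\theta_l\right|\le M^{(i)}_{jkl}(y)$ for almost all $y\in\mathcal X$ and all $\theta\in\Theta^*$, and $E_{\theta^*}[M^{(i)}_{jkl}(Y)]=m_{jkl}<\infty$ with $m_{jkl}$ not depending on $i$, for all $i,j,k,l$. C6. For all $j,k,l$, each of the three sequences (in $i$) $X_i=\partial V_i(Y_i,\theta^*)/\partial\theta_j$, $X_i=\partial^2V_i(Y_i,\theta^*)/\partial\theta_j\partial\theta_k$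 and $X_i=\partial^3V_i(Y_i,\theta^*)/\partial\theta_j\partial\theta_k\partial\theta_l$ is uniformly integrable in the Cesàro sense, i.e. $$\lim_{N\to\infty}\ \sup_{n>1}\ \frac1n\sum_{i=1}^nE_{\theta^*}\left[|X_i|\,\mathbf 1_{\{|X_i|>N\}}\right]=0 .$$ Theorem. Under C1–C6 there exists a sequence of estimators $\widehat\theta_n=\widehat\theta_n(Y_1,\dots,Y_n)\in\Theta$ (measurable functions of the observations) such that, with probability tending to $1$ as $n\to\infty$, $\widehat\theta_n$ solves the system of estimating equations $\partial H_n^\alpha(\theta)/\partial\theta=0_p$, and $\widehat\theta_n\to\theta^*$ in probability. -/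

import Mathlib

open MeasureTheory ProbabilityTheory Filter Topology
open scoped ENNReal

noncomputable section

namespace RenyiPD

/-- The parameter space `ℝᵖ` with its Euclidean norm. -/
abbrev Param (p : ℕ) := EuclideanSpace ℝ (Fin p)

section PartialDerivatives

variable {p : ℕ}

/-- The `j`-th standard basis vector of `ℝᵖ`. -/
def unitVec (j : Fin p) : Param p := EuclideanSpace.single j (1 : ℝ)

/-- The partial derivative `∂g/∂θ_j` at `θ`. -/
def pd (j : Fin p) (g : Param p → ℝ) (θ : Param p) : ℝ := lineDeriv ℝ g θ (unitVec j)

/-- The partial derivative `∂g/∂θ_j` exists at `θ`. -/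
def HasPd (j : Fin p) (g : Param p → ℝ) (θ : Param p) : Prop :=
  LineDifferentiableAt ℝ g θ (unitVec j)

/-- All partial derivatives of `g` of order at most three exist at every point of `U`. -/
def ThricePd (g : Param p → ℝ) (U : Set (Param p)) : Prop :=
  ∀ θ ∈ U, ∀ j k l : Fin p,
    HasPd l g θ ∧ HasPd k (pd l g) θ ∧ HasPd j (pd k (pd l g)) θ

end PartialDerivatives

section Model

variable {𝒴 : Type*} [MeasurableSpace 𝒴] {p : ℕ}

/-- `g(·, θ)`, `θ ∈ Θ`, is a family of probability densities with respect to `μ`. -/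
structure IsDensityFamily (μ : Measure 𝒴) (g : 𝒴 → Param p → ℝ) (Θ : Set (Param p)) : Prop where
  measurable : ∀ θ ∈ Θ, Measurable fun y => g y θ
  nonneg : ∀ θ ∈ Θ, ∀ y, 0 ≤ g y θ
  lintegral_eq_one : ∀ θ ∈ Θ, ∫⁻ y, ENNReal.ofReal (g y θ) ∂μ = 1

/-- The distribution on `𝒴` with density `g(·, θ)` with respect to `μ`. -/
def law (μ : Measure 𝒴) (g : 𝒴 → Param p → ℝ) (θ : Param p) : Measure 𝒴 :=
  μ.withDensity fun y => ENNReal.ofReal (g y θ)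

/-- The contribution `V(y, θ)` of one observation with model density `g` to the objective function:
`g(y, θ)^α / (∫ g(x, θ)^(α+1) dμ(x))^(α/(α+1))` for `α > 0`, and `log g(y, θ)` for `α = 0`. -/
def V (α : ℝ) (μ : Measure 𝒴) (g : 𝒴 → Param p → ℝ) (y : 𝒴) (θ : Param p) : ℝ :=
  if α = 0 then Real.log (g y θ)
  else g y θ ^ α / (∫ x, g x θ ^ (α + 1) ∂μ) ^ (α / (α + 1))

/-- The objective function `H_n^α(θ) = (1/n) ∑_{i<n} V_i(y_i, θ)`. -/
def H (α : ℝ) (μ : Measure 𝒴) (f : ℕ → 𝒴 → Param p → ℝ) (n : ℕ) (y : Fin n → 𝒴)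
    (θ : Param p) : ℝ :=
  (1 / (n : ℝ)) * ∑ i : Fin n, V α μ (f i) (y i) θ

/-- `θ` solves the system `∂H_n^α(θ)/∂θ = 0`: every partial derivative exists there and is `0`. -/
def SolvesEstimatingEquations (α : ℝ) (μ : Measure 𝒴) (f : ℕ → 𝒴 → Param p → ℝ) (n : ℕ)
    (y : Fin n → 𝒴) (θ : Param p) : Prop :=
  ∀ j : Fin p, HasPd j (H α μ f n y) θ ∧ pd j (H α μ f n y) θ = 0

/-- The matrix `J = (-E_{θ₀}[∂²V(Y, θ₀)/∂θ_j∂θ_k])_{j,k}` of one observation. -/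
def J (α : ℝ) (μ : Measure 𝒴) (g : 𝒴 → Param p → ℝ) (θ₀ : Param p) : Matrix (Fin p) (Fin p) ℝ :=
  Matrix.of fun j k => -∫ y, pd j (pd k (V α μ g y)) θ₀ ∂(law μ g θ₀)

/-- The averaged matrix `Ψ_n = (1/n) ∑_{i<n} J⁽ⁱ⁾`. -/
def Psi (α : ℝ) (μ : Measure 𝒴) (f : ℕ → 𝒴 → Param p → ℝ) (θ₀ : Param p) (n : ℕ) :
    Matrix (Fin p) (Fin p) ℝ :=
  (1 / (n : ℝ)) • ∑ i ∈ Finset.range n, J α μ (f i) θ₀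

/-- Uniform integrability in the Cesàro sense of `X_i`, where `X_i` is a random variable on
`(𝒴, ν_i)`: `lim_{N → ∞} sup_{n>1} (1/n) ∑_{i<n} E[|X_i| 1{|X_i| > N}] = 0`. -/
def CesaroUI (ν : ℕ → Measure 𝒴) (X : ℕ → 𝒴 → ℝ) : Prop :=
  Tendsto
    (fun N : ℝ => ⨆ (n : ℕ) (_ : 1 < n), (n : ℝ≥0∞)⁻¹ * ∑ i ∈ Finset.range n,
      ∫⁻ y, {y | N < |X i y|}.indicator (fun y => ‖X i y‖ₑ) y ∂(ν i))
    atTop (𝓝 0)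

/-- C1: all densities have the same support `𝒳`. -/
def CondC1 (f : ℕ → 𝒴 → Param p → ℝ) (Θ : Set (Param p)) (𝒳 : Set 𝒴) : Prop :=
  ∀ i, ∀ θ ∈ Θ, Function.support (fun y => f i y θ) = 𝒳

/-- C2: `U` is an open subset of `Θ` that contains `θ₀`, and for every `i` and almost all `y ∈ 𝒳`
the density `f_i(y, ·)` has all third derivatives on `U`. -/
def CondC2 (μ : Measure 𝒴) (f : ℕ → 𝒴 → Param p → ℝ) (Θ : Set (Param p)) (𝒳 : Set 𝒴)
    (U : Set (Param p)) (θ₀ : Param p) : Prop :=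
  IsOpen U ∧ U ⊆ Θ ∧ θ₀ ∈ U ∧ ∀ i, ∀ᵐ y ∂μ, y ∈ 𝒳 → ThricePd (f i y) U

/-- C3: the integrals `∫ f_i(y, θ)^(1+α) dμ(y)` are finite and can be differentiated three times
with respect to `θ ∈ U`, and the derivatives can be taken under the integral sign. -/
def CondC3 (α : ℝ) (μ : Measure 𝒴) (f : ℕ → 𝒴 → Param p → ℝ) (U : Set (Param p)) : Prop :=
  ∀ i,
    let h : 𝒴 → Param p → ℝ := fun y θ => f i y θ ^ (1 + α)
    let I : Param p → ℝ := fun θ => ∫ y, h y θ ∂μ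
    ThricePd I U ∧ ∀ θ ∈ U,
      Integrable (fun y => h y θ) μ ∧
      ∀ l : Fin p,
        (Integrable (fun y => pd l (h y) θ) μ ∧ pd l I θ = ∫ y, pd l (h y) θ ∂μ) ∧
        ∀ k : Fin p,
          (Integrable (fun y => pd k (pd l (h y)) θ) μ ∧
            pd k (pd l I) θ = ∫ y, pd k (pd l (h y)) θ ∂μ) ∧
          ∀ j : Fin p,
            Integrable (fun y => pd j (pd k (pd l (h y))) θ) μ ∧
              pd j (pd k (pd l I)) θ = ∫ y, pd j (pd k (pd l (h y))) θ ∂μ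

/-- C4: the matrices `J⁽ⁱ⁾` are positive definite, and the infimum over `n ≥ 1` of the smallest
eigenvalue of `Ψ_n` is positive. -/
def CondC4 (α : ℝ) (μ : Measure 𝒴) (f : ℕ → 𝒴 → Param p → ℝ) (θ₀ : Param p) : Prop :=
  (∀ i, (J α μ (f i) θ₀).PosDef) ∧
  ∃ lam₀ : ℝ, 0 < lam₀ ∧ ∀ n : ℕ, 1 ≤ n → ∀ lam ∈ spectrum ℝ (Psi α μ f θ₀ n), lam₀ ≤ lam

/-- C5: on `U` the third derivatives of `V_i(y, ·)` are bounded by functions `M⁽ⁱ⁾_{jkl}(y)` with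
finite expectations `m_{jkl}` that do not depend on `i`. -/
def CondC5 (α : ℝ) (μ : Measure 𝒴) (f : ℕ → 𝒴 → Param p → ℝ) (𝒳 : Set 𝒴) (U : Set (Param p))
    (θ₀ : Param p) : Prop :=
  ∃ (M : ℕ → Fin p → Fin p → Fin p → 𝒴 → ℝ) (m : Fin p → Fin p → Fin p → ℝ), ∀ i j k l,
    (∀ᵐ y ∂μ, y ∈ 𝒳 → ∀ θ ∈ U, |pd j (pd k (pd l (V α μ (f i) y))) θ| ≤ M i j k l y) ∧
    Integrable (M i j k l) (law μ (f i) θ₀) ∧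
    ∫ y, M i j k l y ∂(law μ (f i) θ₀) = m j k l

/-- C6: the first, second and third derivatives of `V_i` at `θ₀` are uniformly integrable in the
Cesàro sense. -/
def CondC6 (α : ℝ) (μ : Measure 𝒴) (f : ℕ → 𝒴 → Param p → ℝ) (θ₀ : Param p) : Prop :=
  ∀ j k l : Fin p,
    CesaroUI (fun i => law μ (f i) θ₀) (fun i y => pd j (V α μ (f i) y) θ₀) ∧
    CesaroUI (fun i => law μ (f i) θ₀) (fun i y => pd j (pd k (V α μ (f i) y)) θ₀) ∧
    CesaroUI (fun i => law μ (f i) θ₀) (fun i y => pd j (pd k (pd l (V α μ (f i) y))) θ₀)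

end Model

end RenyiPD

end

open RenyiPD

/-! Near `θ₀` the objective behaves like a concave quadratic. Its gradient at `θ₀` is an average of
independent scores of mean zero, hence small by a weak law under Cesàro uniform integrability
(`tendsto_measureReal_abs_sum_sub_ge`, `integral_pd_V_eq_zero`). The same law puts its second
derivatives close to those of `-Psi`, and the spectral bound makes `Psi` uniformly positive
definite. Markov's inequality controls the third derivatives.

The deterministic core is `exists_pd_eq_zero_of_close`. On the sphere of radius `a` the quadratic
term pushes the objective strictly below its value at `θ₀`, so its maximum over the closed ball is
interior and is a critical point. Third derivatives up to order `lam / a` are tolerable, so Markov's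
inequality costs a probability proportional to `a`. This cost does not vanish as `n` grows, but it
vanishes as `a` shrinks.

The estimator must be measurable and independent of `a`. It is a measurable choice of the critical
point nearest to `θ₀` in a fixed ball (`exists_measurable_nearest_critical`); whenever a smaller
ball contains a critical point, the nearest one lies there too.

Only partial derivatives are assumed, and only for almost every observation. Smoothness is therefore
replaced by a coordinatewise mean value inequality, and null sets are removed through `GoodSet`. -/

namespace RenyiPD

/-! ### Closure rules for iterated partial derivatives. -/

variable {p : ℕ}

theorem HasPd.hasLineDerivAt {j : Fin p} {g : Param p → ℝ} {θ : Param p} (h : HasPd j g θ) :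
    HasLineDerivAt ℝ g (pd j g θ) θ (unitVec j) :=
  LineDifferentiableAt.hasLineDerivAt h

/-- All partial derivatives of `g` of order at most `n` exist on `U`. -/
def HasPds : ℕ → (Param p → ℝ) → Set (Param p) → Prop
  | 0, _, _ => True
  | n + 1, g, U => ∀ j, (∀ θ ∈ U, HasPd j g θ) ∧ HasPds n (pd j g) U

/-- The recursive form peels off the innermost derivative first, so the rules for sums, products and
powers follow by induction on the order. -/
theorem ThricePd.hasPds {g : Param p → ℝ} {U : Set (Param p)} (h : ThricePd g U) :
    HasPds 3 g U := fun l =>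
  ⟨fun θ hθ => (h θ hθ l l l).1, fun k =>
    ⟨fun θ hθ => (h θ hθ k k l).2.1, fun j => ⟨fun θ hθ => (h θ hθ j k l).2.2, trivial⟩⟩⟩

theorem HasPds.of_succ {n : ℕ} {g : Param p → ℝ} {U : Set (Param p)} (h : HasPds (n + 1) g U) :
    HasPds n g U := by
  induction n generalizing g with
  | zero => trivial
  | succ n ih => exact fun j => ⟨(h j).1, ih (h j).2⟩

theorem pd_congr {j : Fin p} {g g' : Param p → ℝ} {U : Set (Param p)} (hU : IsOpen U)
    (h : Set.EqOn g g' U) : Set.EqOn (pd j g) (pd j g') U := fun _ hθ =>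
  Filter.EventuallyEq.lineDeriv_eq (h.eventuallyEq_of_mem (hU.mem_nhds hθ))

theorem HasPd.congr {j : Fin p} {g g' : Param p → ℝ} {U : Set (Param p)} (hU : IsOpen U)
    (h : Set.EqOn g' g U) {θ : Param p} (hθ : θ ∈ U) (hg : HasPd j g θ) : HasPd j g' θ :=
  LineDifferentiableAt.congr_of_eventuallyEq hg (h.eventuallyEq_of_mem (hU.mem_nhds hθ))

theorem HasPds.congr {n : ℕ} {g g' : Param p → ℝ} {U : Set (Param p)} (hU : IsOpen U)
    (h : Set.EqOn g' g U) (hg : HasPds n g U) : HasPds n g' U := by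
  induction n generalizing g g' with
  | zero => trivial
  | succ n ih =>
    exact fun j => ⟨fun θ hθ => ((hg j).1 θ hθ).congr hU h hθ, ih (pd_congr hU h) (hg j).2⟩

section Rules

variable {g g' : Param p → ℝ} {a a' : ℝ} {θ v : Param p}

theorem hasLineDerivAt_add (h : HasLineDerivAt ℝ g a θ v) (h' : HasLineDerivAt ℝ g' a' θ v) :
    HasLineDerivAt ℝ (fun x => g x + g' x) (a + a') θ v :=
  HasDerivAt.add h h'

theorem hasLineDerivAt_mul (h : HasLineDerivAt ℝ g a θ v) (h' : HasLineDerivAt ℝ g' a' θ v) :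
    HasLineDerivAt ℝ (fun x => g x * g' x) (a * g' θ + g θ * a') θ v := by
  have := HasDerivAt.fun_mul (𝕜 := ℝ) h h'
  simp only [zero_smul, add_zero] at this
  exact this

theorem hasLineDerivAt_const_mul (c : ℝ) (h : HasLineDerivAt ℝ g a θ v) :
    HasLineDerivAt ℝ (fun x => c * g x) (c * a) θ v :=
  HasDerivAt.const_mul c h

theorem hasLineDerivAt_const (c : ℝ) : HasLineDerivAt ℝ (fun _ => c) 0 θ v :=
  hasDerivAt_const (0 : ℝ) c

theorem hasLineDerivAt_sum {ι : Type*} (s : Finset ι) {F : ι → Param p → ℝ} {b : ι → ℝ}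
    (h : ∀ i ∈ s, HasLineDerivAt ℝ (F i) (b i) θ v) :
    HasLineDerivAt ℝ (fun x => ∑ i ∈ s, F i x) (∑ i ∈ s, b i) θ v :=
  HasDerivAt.fun_sum h

theorem hasLineDerivAt_comp {φ : ℝ → ℝ} {b : ℝ} (hφ : HasDerivAt φ b (g θ))
    (h : HasLineDerivAt ℝ g a θ v) :
    HasLineDerivAt ℝ (fun x => φ (g x)) (b * a) θ v := by
  have h0 : HasDerivAt φ b ((fun t : ℝ => g (θ + t • v)) 0) := by simpa using hφ
  exact HasDerivAt.comp (0 : ℝ) h0 h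

end Rules

variable {U : Set (Param p)} {g g' : Param p → ℝ} {n : ℕ}

theorem HasPds.add (hU : IsOpen U) (h : HasPds n g U) (h' : HasPds n g' U) :
    HasPds n (fun x => g x + g' x) U := by
  induction n generalizing g g' with
  | zero => trivial
  | succ n ih =>
    intro j
    have key : ∀ θ ∈ U, HasLineDerivAt ℝ (fun x => g x + g' x) (pd j g θ + pd j g' θ) θ
        (unitVec j) := fun θ hθ =>
      hasLineDerivAt_add ((h j).1 θ hθ).hasLineDerivAt ((h' j).1 θ hθ).hasLineDerivAt
    exact ⟨fun θ hθ => (key θ hθ).lineDifferentiableAt,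
      HasPds.congr hU (fun θ hθ => (key θ hθ).lineDeriv) (ih (h j).2 (h' j).2)⟩

theorem HasPds.mul (hU : IsOpen U) (h : HasPds n g U) (h' : HasPds n g' U) :
    HasPds n (fun x => g x * g' x) U := by
  induction n generalizing g g' with
  | zero => trivial
  | succ n ih =>
    intro j
    have key : ∀ θ ∈ U, HasLineDerivAt ℝ (fun x => g x * g' x)
        (pd j g θ * g' θ + g θ * pd j g' θ) θ (unitVec j) := fun θ hθ =>
      hasLineDerivAt_mul ((h j).1 θ hθ).hasLineDerivAt ((h' j).1 θ hθ).hasLineDerivAt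
    exact ⟨fun θ hθ => (key θ hθ).lineDifferentiableAt,
      HasPds.congr hU (fun θ hθ => (key θ hθ).lineDeriv)
        (HasPds.add hU (ih (h j).2 h'.of_succ) (ih h.of_succ (h' j).2))⟩

theorem HasPds.const (hU : IsOpen U) (c : ℝ) : HasPds n (fun _ : Param p => c) U := by
  induction n generalizing c with
  | zero => trivial
  | succ n ih =>
    exact fun j => ⟨fun θ _ => (hasLineDerivAt_const c).lineDifferentiableAt,
      HasPds.congr hU (fun θ _ => (hasLineDerivAt_const c).lineDeriv) (ih 0)⟩

theorem HasPds.const_mul (hU : IsOpen U) (c : ℝ) (h : HasPds n g U) :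
    HasPds n (fun x => c * g x) U :=
  HasPds.mul hU (HasPds.const hU c) h

theorem HasPds.sum {ι : Type*} (hU : IsOpen U) (s : Finset ι) {F : ι → Param p → ℝ}
    (h : ∀ i ∈ s, HasPds n (F i) U) : HasPds n (fun x => ∑ i ∈ s, F i x) U := by
  classical
  induction s using Finset.induction_on with
  | empty => simpa using HasPds.const hU 0
  | insert i s hi ih =>
    simp only [Finset.sum_insert hi]
    exact HasPds.add hU (h i (Finset.mem_insert_self i s))
      (ih fun k hk => h k (Finset.mem_insert_of_mem hk))

theorem HasPds.rpow (hU : IsOpen U) (hpos : ∀ θ ∈ U, 0 < g θ) (h : HasPds n g U) (c : ℝ) :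
    HasPds n (fun x => g x ^ c) U := by
  induction n generalizing c with
  | zero => trivial
  | succ n ih =>
    intro j
    have key : ∀ θ ∈ U, HasLineDerivAt ℝ (fun x => g x ^ c)
        (c * g θ ^ (c - 1) * pd j g θ) θ (unitVec j) := fun θ hθ =>
      hasLineDerivAt_comp (φ := fun t => t ^ c)
        (Real.hasDerivAt_rpow_const (Or.inl (hpos θ hθ).ne')) ((h j).1 θ hθ).hasLineDerivAt
    exact ⟨fun θ hθ => (key θ hθ).lineDifferentiableAt,
      HasPds.congr hU (fun θ hθ => (key θ hθ).lineDeriv)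
        (HasPds.mul hU (HasPds.const_mul hU c (ih h.of_succ (c - 1))) (h j).2)⟩

/-- Writing the derivative of the logarithm with the real power `-1` reduces everything to
`HasPds.rpow`, so no induction is needed. -/
theorem HasPds.log (hU : IsOpen U) (hpos : ∀ θ ∈ U, 0 < g θ) (h : HasPds n g U) :
    HasPds n (fun x => Real.log (g x)) U := by
  cases n with
  | zero => trivial
  | succ n =>
    intro j
    have key : ∀ θ ∈ U, HasLineDerivAt ℝ (fun x => Real.log (g x))
        (g θ ^ (-1 : ℝ) * pd j g θ) θ (unitVec j) := fun θ hθ => by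
      rw [Real.rpow_neg_one]
      exact hasLineDerivAt_comp (Real.hasDerivAt_log (hpos θ hθ).ne')
        ((h j).1 θ hθ).hasLineDerivAt
    exact ⟨fun θ hθ => (key θ hθ).lineDifferentiableAt,
      HasPds.congr hU (fun θ hθ => (key θ hθ).lineDeriv)
        (HasPds.mul hU (HasPds.rpow hU hpos h.of_succ (-1)) (h j).2)⟩

/-! ### Mean value inequalities and continuity from bounded partial derivatives. -/

theorem abs_sub_le_of_abs_pd_le_segment {j : Fin p} {x : Param p} {c C : ℝ}
    (h : ∀ t ∈ Set.Icc (0 : ℝ) 1, HasPd j g (x + (t * c) • unitVec j) ∧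
      |pd j g (x + (t * c) • unitVec j)| ≤ C) :
    |g (x + c • unitVec j) - g x| ≤ C * |c| := by
  have hd : ∀ t ∈ Set.Icc (0 : ℝ) 1, HasDerivWithinAt (fun t : ℝ => g (x + (t * c) • unitVec j))
      (pd j g (x + (t * c) • unitVec j) * c) (Set.Icc 0 1) t := by
    intro t ht
    have h1 := (h t ht).1.hasLineDerivAt
    -- A line derivative is a derivative at parameter `0`; composing with `s ↦ (s - t) * c` moves it
    -- to the point `t` of the segment.
    have h2 : HasDerivAt (fun s : ℝ => (s - t) * c) c t := by
      simpa using ((hasDerivAt_id t).sub_const t).mul_const c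
    have h3 : HasDerivAt (fun s : ℝ => g (x + (t * c) • unitVec j + s • unitVec j))
        (pd j g (x + (t * c) • unitVec j)) ((fun s : ℝ => (s - t) * c) t) := by
      simpa [HasLineDerivAt] using h1
    have h4 := HasDerivAt.comp t h3 h2
    refine (h4.congr_of_eventuallyEq (Eventually.of_forall fun s => ?_)).hasDerivWithinAt
    simp only [Function.comp]
    congr 1
    rw [add_assoc, ← add_smul]
    congr 2
    ring
  have := Convex.norm_image_sub_le_of_norm_hasDerivWithin_le (C := C * |c|) hd
    (fun t ht => by
      rw [Real.norm_eq_abs, abs_mul]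
      exact mul_le_mul_of_nonneg_right (h t ht).2 (abs_nonneg c))
    (convex_Icc 0 1) (Set.left_mem_Icc.2 zero_le_one) (Set.right_mem_Icc.2 zero_le_one)
  simpa using this

theorem abs_apply_le_norm (θ : Param p) (i : Fin p) : |θ i| ≤ ‖θ‖ := by
  simpa using PiLp.norm_apply_le θ i

theorem norm_le_norm_of_abs_apply_le {x y : Param p} (h : ∀ i, |x i| ≤ |y i|) : ‖x‖ ≤ ‖y‖ := by
  rw [EuclideanSpace.norm_eq, EuclideanSpace.norm_eq]
  refine Real.sqrt_le_sqrt (Finset.sum_le_sum fun i _ => ?_)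
  simpa using sq_le_sq.2 (h i)

/-- A mean value inequality for functions with bounded partial derivatives. -/
theorem abs_sub_le_of_abs_pd_le {θ₀ θ : Param p} {C : ℝ}
    (h : ∀ x, ‖x - θ₀‖ ≤ ‖θ - θ₀‖ → ∀ j, HasPd j g x ∧ |pd j g x| ≤ C) :
    |g θ - g θ₀| ≤ p * C * ‖θ - θ₀‖ := by
  classical
  -- The path from `θ₀` to `θ` changes one coordinate at a time. Every coordinate stays at most as
  -- far from that of `θ₀` as in `θ`, so the path never leaves the ball on which `h` applies.
  let z : Finset (Fin p) → Param p := fun s => WithLp.toLp 2 fun i => if i ∈ s then θ i else θ₀ i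
  have hz : ∀ s i, z s i = if i ∈ s then θ i else θ₀ i := fun s i => rfl
  have key : ∀ s : Finset (Fin p), |g (z s) - g θ₀| ≤ s.card * (C * ‖θ - θ₀‖) := by
    intro s
    induction s using Finset.induction_on with
    | empty =>
      have : z ∅ = θ₀ := by ext i; simp [hz]
      simp [this]
    | insert j s hj ih =>
      have hstep : z (insert j s) = z s + (θ j - θ₀ j) • unitVec j := by
        ext i
        by_cases hij : i = j
        · subst hij; simp [hz, hj, unitVec]
        · simp [hz, hij, unitVec]
      have hC : 0 ≤ C := (abs_nonneg _).trans ((h θ₀ (by simp) j).2)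
      have hseg : |g (z s + (θ j - θ₀ j) • unitVec j) - g (z s)| ≤ C * |θ j - θ₀ j| := by
        refine abs_sub_le_of_abs_pd_le_segment fun t ht => h _ ?_ j
        refine norm_le_norm_of_abs_apply_le fun i => ?_
        by_cases hij : i = j
        · subst hij
          simp only [PiLp.sub_apply, PiLp.add_apply, PiLp.smul_apply, hz, hj, unitVec]
          simp only [if_false, PiLp.single_apply, if_true, smul_eq_mul, mul_one,
            add_sub_cancel_left, abs_mul, abs_of_nonneg ht.1]
          exact mul_le_of_le_one_left (abs_nonneg _) ht.2
        · by_cases his : i ∈ s <;> simp [hz, hij, his, unitVec]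
      have hb : |θ j - θ₀ j| ≤ ‖θ - θ₀‖ := abs_apply_le_norm (θ - θ₀) j
      rw [Finset.card_insert_of_notMem hj, hstep]
      push_cast
      have htri := abs_sub_le (g (z s + (θ j - θ₀ j) • unitVec j)) (g (z s)) (g θ₀)
      have := mul_le_mul_of_nonneg_left hb hC
      linarith
  have hu : z Finset.univ = θ := by ext i; simp [hz]
  have := key Finset.univ
  rw [hu, Finset.card_univ, Fintype.card_fin] at this
  linarith

theorem continuousAt_of_abs_pd_le {θ₀ : Param p} {r C : ℝ} (hr : 0 < r)
    (h : ∀ x ∈ Metric.ball θ₀ r, ∀ j, HasPd j g x ∧ |pd j g x| ≤ C) : ContinuousAt g θ₀ := by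
  refine continuousAt_of_locally_lipschitz hr (p * C) fun θ hθ => ?_
  rw [Real.dist_eq, dist_eq_norm]
  refine abs_sub_le_of_abs_pd_le fun x hx => h x ?_
  rw [mem_ball_iff_norm]
  exact hx.trans_lt (by rwa [← dist_eq_norm])

theorem continuousOn_ball_of_abs_pd_le {θ₀ : Param p} {r C : ℝ}
    (h : ∀ x ∈ Metric.ball θ₀ r, ∀ j, HasPd j g x ∧ |pd j g x| ≤ C) :
    ContinuousOn g (Metric.ball θ₀ r) := by
  intro x hx
  obtain ⟨ε, hε, hball⟩ := Metric.isOpen_iff.1 Metric.isOpen_ball x hx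
  exact (continuousAt_of_abs_pd_le hε fun y hy => h y (hball hy)).continuousWithinAt

/-- Boundedness of a function with bounded partial derivatives on a ball. -/
theorem exists_abs_le_of_abs_pd_le {θ₀ : Param p} {r C : ℝ}
    (h : ∀ x ∈ Metric.ball θ₀ r, ∀ j, HasPd j g x ∧ |pd j g x| ≤ C) :
    ∃ D, ∀ x ∈ Metric.ball θ₀ r, |g x| ≤ D := by
  refine ⟨|g θ₀| + p * |C| * r, fun x hx => ?_⟩
  have h1 : |g x - g θ₀| ≤ p * |C| * ‖x - θ₀‖ := abs_sub_le_of_abs_pd_le fun y hy j => by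
    have := h y (mem_ball_iff_norm.2 (hy.trans_lt (mem_ball_iff_norm.1 hx))) j
    exact ⟨this.1, this.2.trans (le_abs_self C)⟩
  have h2 : p * |C| * ‖x - θ₀‖ ≤ p * |C| * r :=
    mul_le_mul_of_nonneg_left (mem_ball_iff_norm.1 hx).le (by positivity)
  have h3 := abs_sub_abs_le_abs_sub (g x) (g θ₀)
  linarith

/-- If the partial derivatives of order three are bounded on a ball, then the function and its
gradient are continuous there. -/
theorem HasPds.continuousOn_ball {θ₀ : Param p} {r C : ℝ}
    (h : HasPds 3 g (Metric.ball θ₀ r))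
    (hC : ∀ x ∈ Metric.ball θ₀ r, ∀ j k l, |pd j (pd k (pd l g)) x| ≤ C) :
    ContinuousOn g (Metric.ball θ₀ r) ∧ ∀ l, ContinuousOn (pd l g) (Metric.ball θ₀ r) := by
  -- Bounds descend order by order: bounded third derivatives bound the second, which bound the
  -- first; each bound gives continuity one order lower.
  have h2 : ∀ k l, ∃ D, ∀ x ∈ Metric.ball θ₀ r, |pd k (pd l g) x| ≤ D := fun k l =>
    exists_abs_le_of_abs_pd_le fun x hx j => ⟨(((h l).2 k).2 j).1 x hx, hC x hx j k l⟩
  choose D hD using h2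
  have hD' : ∀ l, ∀ x ∈ Metric.ball θ₀ r, ∀ k, HasPd k (pd l g) x ∧
      |pd k (pd l g) x| ≤ ∑ k, |D k l| := fun l x hx k =>
    ⟨((h l).2 k).1 x hx, (hD k l x hx).trans <| (le_abs_self _).trans <|
      Finset.single_le_sum (f := fun k => |D k l|) (fun _ _ => abs_nonneg _) (Finset.mem_univ k)⟩
  have h1 : ∀ l, ∃ E, ∀ x ∈ Metric.ball θ₀ r, |pd l g x| ≤ E := fun l =>
    exists_abs_le_of_abs_pd_le (hD' l)
  choose E hE using h1
  refine ⟨continuousOn_ball_of_abs_pd_le (C := ∑ l, |E l|) fun x hx l => ⟨(h l).1 x hx, ?_⟩,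
    fun l => continuousOn_ball_of_abs_pd_le (hD' l)⟩
  exact (hE l x hx).trans <| (le_abs_self _).trans <|
      Finset.single_le_sum (f := fun k => |E k|) (fun _ _ => abs_nonneg _) (Finset.mem_univ l)

end RenyiPD

/-! ### Existence of a critical point by maximisation over a ball. -/

namespace RenyiPD

variable {p : ℕ}

theorem hasLineDerivAt_coord (θ₀ x : Param p) (i l : Fin p) :
    HasLineDerivAt ℝ (fun x : Param p => x i - θ₀ i) (if i = l then 1 else 0) x (unitVec l) := by
  have h : HasDerivAt (fun t : ℝ => x i + t * (if i = l then 1 else 0) - θ₀ i)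
      (if i = l then 1 else 0) 0 := by
    simpa using (((hasDerivAt_id (0 : ℝ)).mul_const (if i = l then (1 : ℝ) else 0)).const_add
      (x i)).sub_const (θ₀ i)
  simpa [HasLineDerivAt, unitVec, PiLp.single_apply] using h

/-- The gradient of a quadratic form. -/
theorem hasLineDerivAt_quadForm (A : Matrix (Fin p) (Fin p) ℝ) (hA : A.IsSymm) (θ₀ x : Param p)
    (l : Fin p) :
    HasLineDerivAt ℝ
      (fun x : Param p => ∑ j, ∑ k, A j k * ((x j - θ₀ j) * (x k - θ₀ k)))
      (2 * ∑ k, A l k * (x k - θ₀ k)) x (unitVec l) := by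
  have h := hasLineDerivAt_sum Finset.univ fun j _ => hasLineDerivAt_sum Finset.univ fun k _ =>
    hasLineDerivAt_const_mul (A j k)
      (hasLineDerivAt_mul (hasLineDerivAt_coord θ₀ x j l) (hasLineDerivAt_coord θ₀ x k l))
  refine h.congr_deriv ?_
  simp only [mul_add, Finset.sum_add_distrib, ite_mul, mul_ite, one_mul, zero_mul, mul_one,
    mul_zero, Finset.sum_ite_eq', Finset.mem_univ, if_true]
  rw [Finset.sum_comm]
  simp only [Finset.sum_ite_eq', Finset.mem_univ, if_true]
  rw [two_mul]
  congr 1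
  exact Finset.sum_congr rfl fun j _ => by rw [hA.apply]

theorem hasLineDerivAt_linForm (A : Matrix (Fin p) (Fin p) ℝ) (θ₀ x : Param p) (k l : Fin p) :
    HasLineDerivAt ℝ (fun x : Param p => ∑ i, A l i * (x i - θ₀ i)) (A l k) x (unitVec k) := by
  have h := hasLineDerivAt_sum Finset.univ fun i _ =>
    hasLineDerivAt_const_mul (A l i) (hasLineDerivAt_coord θ₀ x i k)
  refine h.congr_deriv ?_
  simp

/-- A function whose gradient at `θ₀` is small and whose Hessian at `θ₀` is close to a negative
definite matrix has a critical point close to `θ₀`. -/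
theorem exists_pd_eq_zero_of_close {g : Param p → ℝ} {θ₀ : Param p} {a lam ε₁ ε₂ K : ℝ}
    {A : Matrix (Fin p) (Fin p) ℝ} (ha : 0 < a)
    (hcont : ContinuousOn g (Metric.closedBall θ₀ a))
    (hpd : ∀ x ∈ Metric.closedBall θ₀ a, ∀ j k l,
      HasPd l g x ∧ HasPd k (pd l g) x ∧ HasPd j (pd k (pd l g)) x ∧
        |pd j (pd k (pd l g)) x| ≤ K)
    (hA : A.IsSymm) (hlam : ∀ h : Param p, lam * ‖h‖ ^ 2 ≤ ∑ j, ∑ k, A j k * (h j * h k))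
    (h₁ : ∀ l, |pd l g θ₀| ≤ ε₁) (h₂ : ∀ k l, |pd k (pd l g) θ₀ + A l k| ≤ ε₂)
    (hsmall : p * a * (ε₁ + p * a * (ε₂ + p * a * K)) < lam / 2 * a ^ 2) :
    ∃ x ∈ Metric.closedBall θ₀ a, ∀ l, pd l g x = 0 := by
  have hθ₀ : θ₀ ∈ Metric.closedBall θ₀ a := Metric.mem_closedBall_self ha.le
  have hmem : ∀ {x y : Param p}, x ∈ Metric.closedBall θ₀ a → ‖y - θ₀‖ ≤ ‖x - θ₀‖ →
      y ∈ Metric.closedBall θ₀ a := fun hx hy =>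
    mem_closedBall_iff_norm.2 (hy.trans (mem_closedBall_iff_norm.1 hx))
  -- Adding the quadratic form back cancels the main part of the Hessian, so `W` has a small
  -- gradient throughout the ball.
  set W : Param p → ℝ := fun x =>
    g x + 1 / 2 * ∑ j, ∑ k, A j k * ((x j - θ₀ j) * (x k - θ₀ k)) with hW
  -- second derivatives of `g` on the ball
  have hH : ∀ x ∈ Metric.closedBall θ₀ a, ∀ k l, |pd k (pd l g) x + A l k| ≤ ε₂ + p * a * K := by
    intro x hx k l
    have hK : 0 ≤ K := (abs_nonneg _).trans (hpd θ₀ hθ₀ k k l).2.2.2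
    have h := abs_sub_le_of_abs_pd_le (g := pd k (pd l g)) (θ₀ := θ₀) (θ := x) (C := K)
      fun y hy j => (hpd y (hmem hx hy) j k l).2.2
    have h' : p * K * ‖x - θ₀‖ ≤ p * K * a :=
      mul_le_mul_of_nonneg_left (mem_closedBall_iff_norm.1 hx) (by positivity)
    have h3 := abs_add_le (pd k (pd l g) θ₀ + A l k) (pd k (pd l g) x - pd k (pd l g) θ₀)
    rw [show pd k (pd l g) θ₀ + A l k + (pd k (pd l g) x - pd k (pd l g) θ₀) =
      pd k (pd l g) x + A l k by ring] at h3
    have := h₂ k l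
    linarith
  have hW' : ∀ x ∈ Metric.closedBall θ₀ a, ∀ l,
      HasLineDerivAt ℝ W (pd l g x + ∑ k, A l k * (x k - θ₀ k)) x (unitVec l) := by
    intro x hx l
    refine (hasLineDerivAt_add (hpd x hx l l l).1.hasLineDerivAt
      (hasLineDerivAt_const_mul (1 / 2) (hasLineDerivAt_quadForm A hA θ₀ x l))).congr_deriv ?_
    ring
  have hG : ∀ x ∈ Metric.closedBall θ₀ a, ∀ l, |pd l g x + ∑ k, A l k * (x k - θ₀ k)| ≤
      ε₁ + p * a * (ε₂ + p * a * K) := by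
    intro x hx l
    have hpos : 0 ≤ ε₂ + p * a * K := (abs_nonneg _).trans (hH x hx l l)
    have h := abs_sub_le_of_abs_pd_le
      (g := fun x => pd l g x + ∑ k, A l k * (x k - θ₀ k)) (θ₀ := θ₀) (θ := x)
      (C := ε₂ + p * a * K) fun y hy k => by
        have hy' := hmem hx hy
        have hd := hasLineDerivAt_add (hpd y hy' k k l).2.1.hasLineDerivAt
          (hasLineDerivAt_linForm A θ₀ y k l)
        exact ⟨hd.lineDifferentiableAt, by rw [pd, hd.lineDeriv]; exact hH y hy' k l⟩
    simp only [sub_self, mul_zero, Finset.sum_const_zero, add_zero] at h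
    have h' : p * (ε₂ + p * a * K) * ‖x - θ₀‖ ≤ p * (ε₂ + p * a * K) * a :=
      mul_le_mul_of_nonneg_left (mem_closedBall_iff_norm.1 hx) (by positivity)
    have h3 := abs_add_le (pd l g θ₀) (pd l g x + ∑ k, A l k * (x k - θ₀ k) - pd l g θ₀)
    rw [add_sub_cancel] at h3
    have := h₁ l
    linarith
  obtain ⟨x, hx, hmax⟩ := (isCompact_closedBall θ₀ a).exists_isMaxOn ⟨θ₀, hθ₀⟩ hcont
  -- At a maximiser on the sphere, `W` would exceed `W θ₀` by at least `lam / 2 * a ^ 2`, against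
  -- the gradient bound and `hsmall`.
  have hlt : ‖x - θ₀‖ < a := by
    refine lt_of_le_of_ne (mem_closedBall_iff_norm.1 hx) fun hxa => ?_
    have h := abs_sub_le_of_abs_pd_le (g := W) (θ₀ := θ₀) (θ := x)
      (C := ε₁ + p * a * (ε₂ + p * a * K)) fun y hy k =>
        ⟨(hW' y (hmem hx hy) k).lineDifferentiableAt, by
          rw [pd, (hW' y (hmem hx hy) k).lineDeriv]; exact hG y (hmem hx hy) k⟩
    have h0 : W θ₀ = g θ₀ := by simp [hW]
    have hq := hlam (x - θ₀)
    have hxW : W x = g x + 1 / 2 * ∑ j, ∑ k, A j k * ((x j - θ₀ j) * (x k - θ₀ k)) := rfl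
    simp only [PiLp.sub_apply] at hq
    rw [hxa] at h hq
    have hge : g θ₀ ≤ g x := hmax hθ₀
    have := (le_abs_self _).trans h
    rw [h0, hxW] at this
    linarith
  refine ⟨x, hx, fun l => IsMaxOn.lineDeriv_eq_zero hmax ?_⟩
  have hc : ContinuousAt (fun t : ℝ => x + t • unitVec l) 0 := by fun_prop
  have hnhds : Metric.closedBall θ₀ a ∈ 𝓝 (x + (0 : ℝ) • unitVec l) := by
    rw [zero_smul, add_zero]
    exact Metric.closedBall_mem_nhds_of_mem (mem_ball_iff_norm.2 hlt)
  exact hc hnhds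

end RenyiPD

/-! ### Measurable selection of zeros on a compact set. -/

namespace RenyiPD

section Selection

variable {X E : Type*} [MeasurableSpace X] [MetricSpace E]

/-- The set of parameters at which a nonnegative Carathéodory function vanishes on a compact set
is nonempty for a measurable set of arguments. -/
theorem measurableSet_exists_eq_zero {K : Set E} (hK : IsCompact K) {g : X → E → ℝ}
    (hcont : ∀ x, ContinuousOn (g x) K) (hmeas : ∀ θ ∈ K, Measurable fun x => g x θ)
    (hnn : ∀ x, ∀ θ ∈ K, 0 ≤ g x θ) : MeasurableSet {x | ∃ θ ∈ K, g x θ = 0} := by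
  obtain ⟨D, hDK, hDc, hKD⟩ := (TopologicalSpace.IsSeparable.exists_countable_dense_subset
    (s := K) hK.isSeparable)
  -- By compactness a zero exists as soon as `g x` takes arbitrarily small values, and by continuity
  -- a countable dense set detects these.
  have hset : {x | ∃ θ ∈ K, g x θ = 0} =
      ⋂ n : ℕ, ⋃ d ∈ D, {x | d ∈ K ∧ g x d < 1 / ((n : ℝ) + 1)} := by
    ext x
    simp only [Set.mem_ofPred_eq, Set.mem_iInter, Set.mem_iUnion, exists_prop]
    constructor
    · rintro ⟨θ, hθ, h0⟩ n
      have hpos : g x θ < 1 / ((n : ℝ) + 1) := by rw [h0]; positivity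
      have hev : ∀ᶠ d in 𝓝[K] θ, g x d < 1 / ((n : ℝ) + 1) :=
        (hcont x θ hθ).eventually (gt_mem_nhds hpos)
      obtain ⟨u, hu, huθ, hsub⟩ := mem_nhdsWithin.1 hev
      obtain ⟨d, hdu, hdD⟩ := mem_closure_iff.1 (hKD hθ) u hu huθ
      exact ⟨d, hdD, hDK hdD, hsub ⟨hdu, hDK hdD⟩⟩
    · intro h
      have hne : K.Nonempty := by
        obtain ⟨d, _, hd, _⟩ := h 0
        exact ⟨d, hd⟩
      obtain ⟨θ, hθ, hmin⟩ := hK.exists_isMinOn hne (hcont x)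
      refine ⟨θ, hθ, le_antisymm (le_of_forall_pos_lt_add fun ε hε => ?_) (hnn x θ hθ)⟩
      obtain ⟨n, hn⟩ := exists_nat_one_div_lt hε
      obtain ⟨d, _, hd, hlt⟩ := h n
      rw [zero_add]
      exact (hmin hd).trans_lt (hlt.trans hn)
  rw [hset]
  refine MeasurableSet.iInter fun n => MeasurableSet.biUnion hDc fun d hd => ?_
  have : {x | d ∈ K ∧ g x d < 1 / ((n : ℝ) + 1)} = {x | g x d < 1 / ((n : ℝ) + 1)} := by
    ext x; simp [hDK hd]
  rw [this]
  exact measurableSet_lt (hmeas d (hDK hd)) measurable_const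

/-- A nonnegative Carathéodory function on a compact set all of whose sections have a zero. -/
structure IsZeroFamily (K : Set E) (g : X → E → ℝ) : Prop where
  cont : ∀ x, ContinuousOn (g x) K
  meas : ∀ θ ∈ K, Measurable fun x => g x θ
  nonneg : ∀ x, ∀ θ ∈ K, 0 ≤ g x θ
  exists_zero : ∀ x, ∃ θ ∈ K, g x θ = 0

/-- Adding the distance of `φ` from its minimum over the zeros cuts the zero set down to the
minimisers. That minimum is measurable in `x`, since it is at most `c` exactly when `g x` has a zero
in the compact set `K ∩ {φ ≤ c}`. -/
theorem IsZeroFamily.exists_minimizing {K : Set E} (hK : IsCompact K) {g : X → E → ℝ}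
    (hg : IsZeroFamily K g) {φ : E → ℝ} (hφ : Continuous φ) :
    ∃ g' : X → E → ℝ, IsZeroFamily K g' ∧ ∀ x, ∀ θ ∈ K, g' x θ = 0 →
      g x θ = 0 ∧ ∀ η ∈ K, g x η = 0 → φ θ ≤ φ η := by
  have hmin : ∀ x, ∃ θ ∈ K, g x θ = 0 ∧ ∀ η ∈ K, g x η = 0 → φ θ ≤ φ η := by
    intro x
    have hcl : IsCompact (K ∩ g x ⁻¹' {0}) :=
      hK.of_isClosed_subset
        ((hg.cont x).preimage_isClosed_of_isClosed hK.isClosed isClosed_singleton)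
        Set.inter_subset_left
    obtain ⟨θ₁, h₁, h₁'⟩ := hg.exists_zero x
    obtain ⟨θ, hθ, hm⟩ := hcl.exists_isMinOn ⟨θ₁, h₁, h₁'⟩ hφ.continuousOn
    exact ⟨θ, hθ.1, hθ.2, fun η hη hη' => hm ⟨hη, hη'⟩⟩
  choose m hmK hm0 hmm using hmin
  have hτ : Measurable fun x => φ (m x) := by
    refine measurable_of_Iic fun c => ?_
    have : (fun x => φ (m x)) ⁻¹' Set.Iic c = {x | ∃ θ ∈ K ∩ φ ⁻¹' Set.Iic c, g x θ = 0} := by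
      ext x
      constructor
      · exact fun h => ⟨m x, ⟨hmK x, h⟩, hm0 x⟩
      · rintro ⟨θ, ⟨hθ, hc⟩, h0⟩
        exact (hmm x θ hθ h0).trans hc
    rw [this]
    exact measurableSet_exists_eq_zero (hK.inter_right (isClosed_Iic.preimage hφ))
      (fun x => (hg.cont x).mono Set.inter_subset_left) (fun θ hθ => hg.meas θ hθ.1)
      (fun x θ hθ => hg.nonneg x θ hθ.1)
  refine ⟨fun x θ => g x θ + |φ θ - φ (m x)|, ⟨fun x => ?_, fun θ hθ => ?_, fun x θ hθ => ?_,
    fun x => ⟨m x, hmK x, by simp [hm0]⟩⟩, fun x θ hθ h => ?_⟩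
  · exact (hg.cont x).add (by fun_prop)
  · exact (hg.meas θ hθ).add (measurable_const.sub hτ).abs
  · exact add_nonneg (hg.nonneg x θ hθ) (abs_nonneg _)
  · have h1 := hg.nonneg x θ hθ
    have h2 := abs_nonneg (φ θ - φ (m x))
    have h3 : φ θ - φ (m x) = 0 := abs_eq_zero.1 (by linarith)
    refine ⟨by linarith, fun η hη hη' => ?_⟩
    have := hmm x η hη hη'
    linarith

/-- By uniqueness, the selected zero lies in a closed `C` exactly when there is some zero in the
compact set `K ∩ C`. -/
theorem IsZeroFamily.measurable_of_unique [MeasurableSpace E] [BorelSpace E] {K : Set E}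
    (hK : IsCompact K) {g : X → E → ℝ} (hg : IsZeroFamily K g) {T : X → E} (hTK : ∀ x, T x ∈ K)
    (hT : ∀ x, g x (T x) = 0) (huniq : ∀ x, ∀ θ ∈ K, g x θ = 0 → θ = T x) : Measurable T := by
  refine measurable_of_isClosed fun C hC => ?_
  have : T ⁻¹' C = {x | ∃ θ ∈ K ∩ C, g x θ = 0} := by
    ext x
    constructor
    · exact fun h => ⟨T x, ⟨hTK x, h⟩, hT x⟩
    · rintro ⟨θ, ⟨hθ, hc⟩, h0⟩
      rw [huniq x θ hθ h0] at hc
      exact hc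
  rw [this]
  exact measurableSet_exists_eq_zero (hK.inter_right hC)
    (fun x => (hg.cont x).mono Set.inter_subset_left) (fun θ hθ => hg.meas θ hθ.1)
    (fun x θ hθ => hg.nonneg x θ hθ.1)

end Selection

variable {X : Type*} [MeasurableSpace X] {p : ℕ}

/-- Measurable selection of a zero that minimises a continuous function among all zeros. -/
theorem IsZeroFamily.exists_measurable_minimizer {K : Set (Param p)} (hK : IsCompact K)
    {g : X → Param p → ℝ} (hg : IsZeroFamily K g) {φ : Param p → ℝ} (hφ : Continuous φ) :
    ∃ T : X → Param p, Measurable T ∧ (∀ x, T x ∈ K) ∧ (∀ x, g x (T x) = 0) ∧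
      ∀ x, ∀ η ∈ K, g x η = 0 → φ (T x) ≤ φ η := by
  classical
  obtain ⟨g₀, hg₀, hmin⟩ := hg.exists_minimizing hK hφ
  -- Ties are broken by minimising the coordinates in turn; once all are fixed, a single zero
  -- remains.
  have key : ∀ s : Finset (Fin p), ∃ g' : X → Param p → ℝ, IsZeroFamily K g' ∧
      (∀ x, ∀ θ ∈ K, g' x θ = 0 → g₀ x θ = 0) ∧
      ∀ x, ∀ θ ∈ K, ∀ η ∈ K, g' x θ = 0 → g' x η = 0 → ∀ i ∈ s, θ i = η i := by
    intro s
    induction s using Finset.induction_on with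
    | empty => exact ⟨g₀, hg₀, fun _ _ _ h => h, by simp⟩
    | insert j s hj ih =>
      obtain ⟨g₁, h₁, hsub, hs⟩ := ih
      obtain ⟨g₂, h₂, hm⟩ := h₁.exists_minimizing hK
        (φ := fun θ : Param p => θ j) (by fun_prop)
      refine ⟨g₂, h₂, fun x θ hθ h => hsub x θ hθ (hm x θ hθ h).1, ?_⟩
      intro x θ hθ η hη h h' i hi
      obtain ⟨ha, hb⟩ := hm x θ hθ h
      obtain ⟨ha', hb'⟩ := hm x η hη h'
      rcases Finset.mem_insert.1 hi with rfl | hi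
      · exact le_antisymm (hb η hη ha') (hb' θ hθ ha)
      · exact hs x θ hθ η hη ha ha' i hi
  obtain ⟨g', h', hsub, hu⟩ := key Finset.univ
  choose T hTK hT using h'.exists_zero
  refine ⟨T, h'.measurable_of_unique hK hTK hT fun x θ hθ h => ?_, hTK,
    fun x => (hmin x _ (hTK x) (hsub x _ (hTK x) (hT x))).1,
    fun x => (hmin x _ (hTK x) (hsub x _ (hTK x) (hT x))).2⟩
  ext i
  exact hu x θ hθ _ (hTK x) h (hT x) i (Finset.mem_univ i)

/-- Measurable selection of a zero that is closest to a given point, if there is a zero. -/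
theorem exists_measurable_nearest_zero {K : Set (Param p)} (hK : IsCompact K)
    {g : X → Param p → ℝ} {θ₀ : Param p} (hθ₀ : θ₀ ∈ K)
    (hcont : ∀ x, ContinuousOn (g x) K) (hmeas : ∀ θ ∈ K, Measurable fun x => g x θ)
    (hnn : ∀ x, ∀ θ ∈ K, 0 ≤ g x θ) :
    ∃ T : X → Param p, Measurable T ∧ (∀ x, T x ∈ K) ∧
      ∀ x, ∀ η ∈ K, g x η = 0 → g x (T x) = 0 ∧ ‖T x - θ₀‖ ≤ ‖η - θ₀‖ := by
  classical
  set A : Set X := {x | ∃ θ ∈ K, g x θ = 0} with hAdef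
  have hA : MeasurableSet A := measurableSet_exists_eq_zero hK hcont hmeas hnn
  -- Where `g x` has no zero, `‖θ - θ₀‖` takes its place, so the selection defaults to `θ₀`.
  have hg : IsZeroFamily K fun x θ => if x ∈ A then g x θ else ‖θ - θ₀‖ := by
    refine ⟨fun x => ?_, fun θ hθ => Measurable.ite hA (hmeas θ hθ) measurable_const,
      fun x θ hθ => ?_, fun x => ?_⟩
    · by_cases hx : x ∈ A
      · simpa [hx] using hcont x
      · simp only [hx, if_false]; fun_prop
    · by_cases hx : x ∈ A
      · simpa [hx] using hnn x θ hθ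
      · simp [hx]
    · by_cases hx : x ∈ A
      · simp only [if_pos hx]; exact hx
      · exact ⟨θ₀, hθ₀, by simp [hx]⟩
  obtain ⟨T, hT, hTK, hT0, hmin⟩ := hg.exists_measurable_minimizer hK
    (φ := fun θ => ‖θ - θ₀‖) (by fun_prop)
  refine ⟨T, hT, hTK, fun x η hη h0 => ?_⟩
  have hx : x ∈ A := ⟨η, hη, h0⟩
  have h1 := hT0 x
  have h2 := hmin x η hη
  simp only [hx, if_true] at h1 h2
  exact ⟨h1, h2 h0⟩

end RenyiPD

/-! ### Cesàro uniform integrability and the weak law of large numbers. -/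

namespace RenyiPD

/-- The part of `x` that exceeds `N` in absolute value. -/
noncomputable def tail (N : ℝ) (x : ℝ) : ℝ := if N < |x| then x else 0

theorem measurable_tail (N : ℝ) : Measurable (tail N) :=
  Measurable.ite (measurableSet_lt measurable_const measurable_id.abs) measurable_id
    measurable_const

theorem abs_tail_le (N x : ℝ) : |tail N x| ≤ |x| := by
  unfold tail; split_ifs <;> simp

theorem abs_sub_tail_le {N : ℝ} (hN : 0 ≤ N) (x : ℝ) : |x - tail N x| ≤ N := by
  unfold tail; split_ifs with h
  · simpa using hN
  · simpa using h

theorem indicator_enorm_eq {X : Type*} (N : ℝ) (F : X → ℝ) :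
    {y | N < |F y|}.indicator (fun y => ‖F y‖ₑ) = fun y => ‖tail N (F y)‖ₑ := by
  funext y
  by_cases h : N < |F y| <;> simp [tail, h]

section CesaroUI

variable {𝒴 : Type*} [MeasurableSpace 𝒴] {ν : ℕ → Measure 𝒴} {X X' : ℕ → 𝒴 → ℝ}

/-- Allows derivatives, whose measurability in `y` is not assumed, to be exchanged for their
measurable restrictions to a set of full measure. -/
theorem CesaroUI.congr (h : ∀ i, X i =ᵐ[ν i] X' i) (hX : CesaroUI ν X) : CesaroUI ν X' := by
  unfold CesaroUI at hX ⊢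
  simp only [indicator_enorm_eq] at hX ⊢
  convert hX using 2 with N
  refine iSup_congr fun n => iSup_congr fun _ => ?_
  congr 1
  refine Finset.sum_congr rfl fun i _ => lintegral_congr_ae ?_
  filter_upwards [h i] with y hy
  rw [hy]

theorem CesaroUI.exists_sum_lintegral_le (hX : CesaroUI ν X) {ε : ℝ≥0∞} (hε : 0 < ε) :
    ∃ N : ℝ, 0 ≤ N ∧ ∀ n : ℕ, 1 < n →
      ∑ i ∈ Finset.range n, ∫⁻ y, ‖tail N (X i y)‖ₑ ∂(ν i) ≤ n * ε := by
  unfold CesaroUI at hX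
  simp only [indicator_enorm_eq] at hX
  obtain ⟨N, hN, hN0⟩ := ((ENNReal.tendsto_nhds_zero.1 hX ε hε).and (eventually_ge_atTop 0)).exists
  refine ⟨N, hN0, fun n hn => ?_⟩
  have := (le_iSup₂ (f := fun (n : ℕ) (_ : 1 < n) => (n : ℝ≥0∞)⁻¹ * ∑ i ∈ Finset.range n,
      ∫⁻ y, ‖tail N (X i y)‖ₑ ∂(ν i)) n hn).trans hN
  rwa [ENNReal.inv_mul_le_iff (by simp; omega) (by simp)] at this

theorem CesaroUI.integrable [∀ i, IsProbabilityMeasure (ν i)] (hX : CesaroUI ν X)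
    (hm : ∀ i, Measurable (X i)) (i : ℕ) : Integrable (X i) (ν i) := by
  obtain ⟨N, hN, h⟩ := hX.exists_sum_lintegral_le zero_lt_one
  -- The term `i` occurs in the average over `i + 2` terms, a length that is always above `1` as the
  -- supremum requires.
  have hi : ∫⁻ y, ‖tail N (X i y)‖ₑ ∂(ν i) < ∞ := by
    refine lt_of_le_of_lt ((Finset.single_le_sum
      (f := fun i => ∫⁻ y, ‖tail N (X i y)‖ₑ ∂(ν i)) (fun _ _ => zero_le)
      (Finset.mem_range.2 (by omega : i < i + 2))).trans (h (i + 2) (by omega))) ?_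
    rw [mul_one]
    exact ENNReal.natCast_lt_top _
  have h1 : Integrable (fun y => tail N (X i y)) (ν i) :=
    ⟨((measurable_tail N).comp (hm i)).aestronglyMeasurable, hi⟩
  have h2 : Integrable (fun y => X i y - tail N (X i y)) (ν i) :=
    Integrable.of_bound ((hm i).sub ((measurable_tail N).comp (hm i))).aestronglyMeasurable N
      (Eventually.of_forall fun y => abs_sub_tail_le hN _)
  exact (h1.add h2).congr (Eventually.of_forall fun y => by simp)

theorem CesaroUI.exists_sum_integral_le [∀ i, IsProbabilityMeasure (ν i)] (hX : CesaroUI ν X)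
    (hm : ∀ i, Measurable (X i)) {ε : ℝ} (hε : 0 < ε) :
    ∃ N : ℝ, 0 ≤ N ∧ ∀ n : ℕ, 1 < n →
      ∑ i ∈ Finset.range n, ∫ y, |tail N (X i y)| ∂(ν i) ≤ n * ε := by
  obtain ⟨N, hN, h⟩ := hX.exists_sum_lintegral_le (ENNReal.ofReal_pos.2 hε)
  refine ⟨N, hN, fun n hn => ?_⟩
  have hint : ∀ i, Integrable (fun y => tail N (X i y)) (ν i) := fun i =>
    (hX.integrable hm i).mono ((measurable_tail N).comp (hm i)).aestronglyMeasurable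
      (Eventually.of_forall fun y => abs_tail_le _ _)
  have h1 := h n hn
  have h2 : ∀ i, ∫⁻ y, ‖tail N (X i y)‖ₑ ∂(ν i) =
      ENNReal.ofReal (∫ y, |tail N (X i y)| ∂(ν i)) := fun i =>
    (ofReal_integral_norm_eq_lintegral_enorm (hint i)).symm
  simp only [h2] at h1
  rw [← ENNReal.ofReal_sum_of_nonneg (fun i _ => integral_nonneg fun _ => abs_nonneg _),
    ← ENNReal.ofReal_natCast n, ← ENNReal.ofReal_mul (by positivity)] at h1
  exact (ENNReal.ofReal_le_ofReal_iff (by positivity)).1 h1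

end CesaroUI

section WeakLaw

variable {Ω : Type*} [MeasurableSpace Ω] {P : Measure Ω} [IsProbabilityMeasure P]

/-- A tail bound for sums of independent random variables by truncation. -/
theorem measureReal_abs_sum_sub_ge_le {X : ℕ → Ω → ℝ} (hX : ∀ i, Measurable (X i))
    (hindep : iIndepFun X P) (hint : ∀ i, Integrable (X i) P) {c ε N : ℝ} (hc : 0 < c)
    (hε : ε ≤ c / 4) (hN : 0 ≤ N) {n : ℕ} (hn : 0 < n)
    (htail : ∑ i ∈ Finset.range n, ∫ ω, |tail N (X i ω)| ∂P ≤ n * ε) :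
    P.real {ω | c * n ≤ |∑ i ∈ Finset.range n, (X i ω - ∫ ω, X i ω ∂P)|} ≤
      4 * N ^ 2 / (c ^ 2 * n) + 4 * ε / c := by
  have hn' : (0 : ℝ) < n := by exact_mod_cast hn
  have hZm : ∀ i, Measurable fun ω => tail N (X i ω) := fun i => (measurable_tail N).comp (hX i)
  have hZint : ∀ i, Integrable (fun ω => tail N (X i ω)) P := fun i =>
    (hint i).mono (hZm i).aestronglyMeasurable (Eventually.of_forall fun y => abs_tail_le _ _)
  -- The deviation `c * n` is split as follows: half for the bounded parts (Chebyshev), a quarter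
  -- for the tails (Markov), a quarter for the means of the tails.
  set B : ℕ → Ω → ℝ := fun i ω => X i ω - tail N (X i ω) with hB
  have hBm : ∀ i, Measurable (B i) := fun i => (hX i).sub (hZm i)
  have hBb : ∀ i ω, |B i ω| ≤ N := fun i ω => abs_sub_tail_le hN _
  have hBint : ∀ i, Integrable (B i) P := fun i => (hint i).sub (hZint i)
  have hBL : ∀ i, MemLp (B i) 2 P := fun i =>
    MemLp.of_bound (hBm i).aestronglyMeasurable N (Eventually.of_forall fun ω => hBb i ω)
  set S : Ω → ℝ := ∑ i ∈ Finset.range n, B i with hS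
  have hSL : MemLp S 2 P := memLp_finsetSum' _ fun i _ => hBL i
  have hSE : P[S] = ∑ i ∈ Finset.range n, ∫ ω, B i ω ∂P := by
    simp only [hS, Finset.sum_apply]
    exact integral_finsetSum _ fun i _ => hBint i
  have hvar : variance S P ≤ n * N ^ 2 := by
    rw [hS, IndepFun.variance_sum (fun i _ => hBL i) fun i _ j _ hij =>
      (hindep.indepFun hij).comp (φ := fun x => x - tail N x) (ψ := fun x => x - tail N x)
        (measurable_id.sub (measurable_tail N)) (measurable_id.sub (measurable_tail N))]
    have : ∀ i ∈ Finset.range n, variance (B i) P ≤ N ^ 2 := fun i _ => by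
      have := variance_le_sq_of_bounded (μ := P) (X := B i) (a := -N) (b := N)
        (Eventually.of_forall fun ω => abs_le.1 (hBb i ω)) (hBm i).aemeasurable
      convert this using 2
      ring
    simpa using Finset.sum_le_sum this
  have h1 : P.real {ω | c * n / 2 ≤ |S ω - P[S]|} ≤ 4 * N ^ 2 / (c ^ 2 * n) := by
    have hpos : 0 < c * n / 2 := by positivity
    have := ENNReal.toReal_le_of_le_ofReal (div_nonneg (variance_nonneg _ _) (sq_nonneg _))
      (meas_ge_le_variance_div_sq hSL hpos)
    refine this.trans ((div_le_div_of_nonneg_right hvar (by positivity)).trans_eq ?_)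
    field_simp
    ring
  have h2 : P.real {ω | c * n / 4 ≤ ∑ i ∈ Finset.range n, |tail N (X i ω)|} ≤ 4 * ε / c := by
    have hM := mul_meas_ge_le_integral_of_nonneg (μ := P)
      (f := fun ω => ∑ i ∈ Finset.range n, |tail N (X i ω)|)
      (Eventually.of_forall fun ω => Finset.sum_nonneg fun i _ => abs_nonneg _)
      (integrable_finsetSum _ fun i _ => (hZint i).abs) (c * n / 4)
    rw [integral_finsetSum _ fun i _ => (hZint i).abs] at hM
    rw [le_div_iff₀ hc]
    have := hM.trans htail
    rw [← mul_le_mul_iff_of_pos_left (show (0 : ℝ) < n / 4 by positivity)]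
    linarith
  refine (measureReal_mono ?_ (measure_ne_top _ _)).trans
    ((measureReal_union_le _ _).trans (add_le_add h1 h2))
  intro ω hω
  by_contra hcon
  simp only [Set.mem_union, Set.mem_ofPred_eq, not_or, not_le] at hcon hω
  obtain ⟨hc1, hc2⟩ := hcon
  have hdecomp : ∑ i ∈ Finset.range n, (X i ω - ∫ ω, X i ω ∂P) = (S ω - P[S]) +
      (∑ i ∈ Finset.range n, tail N (X i ω) - ∑ i ∈ Finset.range n, ∫ ω, tail N (X i ω) ∂P) := by
    rw [hSE]
    simp only [hS, Finset.sum_apply, ← Finset.sum_sub_distrib, ← Finset.sum_add_distrib]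
    refine Finset.sum_congr rfl fun i _ => ?_
    simp only [hB]
    rw [integral_sub (hint i) (hZint i)]
    ring
  have h3 : |∑ i ∈ Finset.range n, tail N (X i ω)| ≤ ∑ i ∈ Finset.range n, |tail N (X i ω)| :=
    Finset.abs_sum_le_sum_abs _ _
  have h4 : |∑ i ∈ Finset.range n, ∫ ω, tail N (X i ω) ∂P| ≤ n * ε :=
    (Finset.abs_sum_le_sum_abs _ _).trans
      ((Finset.sum_le_sum fun i _ => abs_integral_le_integral_abs).trans htail)
  have h5 : (n : ℝ) * ε ≤ n * (c / 4) := mul_le_mul_of_nonneg_left hε hn'.le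
  rw [hdecomp] at hω
  have h6 := abs_add_le (S ω - P[S])
    (∑ i ∈ Finset.range n, tail N (X i ω) - ∑ i ∈ Finset.range n, ∫ ω, tail N (X i ω) ∂P)
  have h7 := abs_sub (∑ i ∈ Finset.range n, tail N (X i ω))
    (∑ i ∈ Finset.range n, ∫ ω, tail N (X i ω) ∂P)
  linarith

/-- The weak law of large numbers for independent random variables that are uniformly integrable
in the Cesàro sense. -/
theorem tendsto_measureReal_abs_sum_sub_ge {𝒴 : Type*} [MeasurableSpace 𝒴] {Y : ℕ → Ω → 𝒴}
    (hY : ∀ i, Measurable (Y i)) (hindep : iIndepFun Y P) {X : ℕ → 𝒴 → ℝ}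
    (hX : ∀ i, Measurable (X i)) (hUI : CesaroUI (fun i => P.map (Y i)) X) {c : ℝ} (hc : 0 < c) :
    Tendsto (fun n : ℕ => P.real {ω | c * n ≤
      |∑ i ∈ Finset.range n, (X i (Y i ω) - ∫ y, X i y ∂(P.map (Y i)))|}) atTop (𝓝 0) := by
  have hprob : ∀ i, IsProbabilityMeasure (P.map (Y i)) := fun i =>
    Measure.isProbabilityMeasure_map (hY i).aemeasurable
  have hE : ∀ i, ∫ y, X i y ∂(P.map (Y i)) = ∫ ω, X i (Y i ω) ∂P := fun i =>
    integral_map (hY i).aemeasurable (hX i).aestronglyMeasurable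
  simp only [hE]
  rw [Metric.tendsto_atTop]
  intro δ hδ
  -- The bound `c / 4` is what the tail estimate demands; `c * δ / 16` makes its Markov term at most
  -- `δ / 4`.
  have hε : 0 < min (c / 4) (c * δ / 16) := by positivity
  obtain ⟨N, hN, htail⟩ := hUI.exists_sum_integral_le hX hε
  have hlim : Tendsto (fun n : ℕ => 4 * N ^ 2 / (c ^ 2 * n)) atTop (𝓝 0) :=
    Tendsto.const_div_atTop (Tendsto.const_mul_atTop (by positivity) tendsto_natCast_atTop_atTop) _
  obtain ⟨n₀, hn₀⟩ := eventually_atTop.1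
    ((hlim.eventually (gt_mem_nhds (half_pos hδ))).and (eventually_gt_atTop 1))
  refine ⟨n₀, fun n hn => ?_⟩
  obtain ⟨hsmall, hn1⟩ := hn₀ n hn
  have ht : ∑ i ∈ Finset.range n, ∫ ω, |tail N (X i (Y i ω))| ∂P ≤
      n * min (c / 4) (c * δ / 16) := by
    refine le_trans (le_of_eq (Finset.sum_congr rfl fun i _ => ?_)) (htail n hn1)
    exact (integral_map (hY i).aemeasurable
      ((measurable_tail N).comp (hX i)).abs.aestronglyMeasurable).symm
  have hb := measureReal_abs_sum_sub_ge_le (P := P) (X := fun i ω => X i (Y i ω))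
    (fun i => (hX i).comp (hY i)) (hindep.comp _ hX)
    (fun i => (hUI.integrable hX i).comp_measurable (hY i)) hc (min_le_left _ _) hN
    (by omega : 0 < n) ht
  have h4 : 4 * min (c / 4) (c * δ / 16) / c ≤ δ / 4 := by
    rw [div_le_iff₀ hc]
    have := min_le_right (c / 4) (c * δ / 16)
    linarith
  rw [Real.dist_eq, sub_zero, abs_of_nonneg measureReal_nonneg]
  linarith

end WeakLaw

end RenyiPD

/-! ### One observation: measurability, smoothness of `V` and the mean of the score. -/

namespace RenyiPD

variable {𝒴 : Type*} [MeasurableSpace 𝒴] {p : ℕ}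

/-- Partial derivatives of a function that is measurable in its first argument are measurable. -/
theorem measurable_indicator_pd {U : Set (Param p)} (hU : IsOpen U) {G : Set 𝒴}
    {F : 𝒴 → Param p → ℝ} (hF : ∀ θ ∈ U, Measurable (G.indicator fun y => F y θ)) {j : Fin p}
    (hpd : ∀ y ∈ G, ∀ θ ∈ U, HasPd j (F y) θ) {θ : Param p} (hθ : θ ∈ U) :
    Measurable (G.indicator fun y => pd j (F y) θ) := by
  have hc : ContinuousAt (fun t : ℝ => θ + t • unitVec j) 0 := by fun_prop
  have hnh : U ∈ 𝓝 (θ + (0 : ℝ) • unitVec j) := by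
    rw [zero_smul, add_zero]; exact hU.mem_nhds hθ
  obtain ⟨δ, hδ, hball⟩ := Metric.mem_nhds_iff.1 (hc hnh)
  set s : ℕ → ℝ := fun n => δ / 2 * (1 / ((n : ℝ) + 1)) with hs
  have hspos : ∀ n, 0 < s n := fun n => by positivity
  have hsmem : ∀ n, θ + s n • unitVec j ∈ U := fun n => hball (by
    rw [mem_ball_zero_iff, Real.norm_eq_abs, abs_of_pos (hspos n)]
    have h1 : 1 / ((n : ℝ) + 1) ≤ 1 := by
      rw [div_le_one (by positivity)]; linarith [(Nat.cast_nonneg n : (0 : ℝ) ≤ n)]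
    have : s n ≤ δ / 2 * 1 := mul_le_mul_of_nonneg_left h1 (by positivity)
    linarith)
  have hst : Tendsto s atTop (𝓝[>] 0) := by
    refine tendsto_nhdsWithin_iff.2 ⟨?_, Eventually.of_forall hspos⟩
    simpa [hs] using tendsto_one_div_add_atTop_nhds_zero_nat.const_mul (δ / 2)
  refine measurable_of_tendsto_metrizable
    (f := fun n y => (s n)⁻¹ * (G.indicator (fun y => F y (θ + s n • unitVec j)) y -
      G.indicator (fun y => F y θ) y))
    (fun n => measurable_const.mul ((hF _ (hsmem n)).sub (hF θ hθ))) ?_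
  refine tendsto_pi_nhds.2 fun y => ?_
  by_cases hy : y ∈ G
  · simp only [Set.indicator_of_mem hy]
    exact (hpd y hy θ hθ).hasLineDerivAt.tendsto_slope_zero_right.comp hst
  · simp [hy]

section SingleModel

variable {μ : Measure 𝒴} {g : 𝒴 → Param p → ℝ} {Θ U : Set (Param p)} {𝒳 : Set 𝒴} {α : ℝ}
  {θ₀ : Param p}

theorem pos_of_mem_support (hg : IsDensityFamily μ g Θ)
    (hsupp : ∀ θ ∈ Θ, Function.support (fun y => g y θ) = 𝒳) {y : 𝒴} (hy : y ∈ 𝒳) {θ : Param p}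
    (hθ : θ ∈ Θ) : 0 < g y θ := by
  rw [← hsupp θ hθ] at hy
  exact (hg.nonneg θ hθ y).lt_of_ne' hy

theorem eq_zero_of_notMem_support {X : Type*} {g : X → Param p → ℝ} {𝒳 : Set X}
    (hsupp : ∀ θ ∈ Θ, Function.support (fun y => g y θ) = 𝒳) {y : X} (hy : y ∉ 𝒳) {θ : Param p} (hθ : θ ∈ Θ) : g y θ = 0 := by
  rw [← hsupp θ hθ] at hy
  simpa using hy

theorem ae_law_of_ae (hg : IsDensityFamily μ g Θ) (hθ₀ : θ₀ ∈ Θ)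
    (hsupp : ∀ θ ∈ Θ, Function.support (fun y => g y θ) = 𝒳) {q : 𝒴 → Prop}
    (h : ∀ᵐ y ∂μ, y ∈ 𝒳 → q y) : ∀ᵐ y ∂(law μ g θ₀), q y := by
  rw [law, ae_withDensity_iff (hg.measurable θ₀ hθ₀).ennreal_ofReal]
  filter_upwards [h] with y hy h0
  refine hy ?_
  by_contra hy'
  exact h0 (by rw [eq_zero_of_notMem_support hsupp hy' hθ₀, ENNReal.ofReal_zero])

/-- If the integral vanished, the density would be zero almost everywhere and could not have total
mass one. -/
theorem integral_rpow_pos (hg : IsDensityFamily μ g Θ) {θ : Param p} (hθ : θ ∈ Θ) {c : ℝ}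
    (hint : Integrable (fun y => g y θ ^ c) μ) : 0 < ∫ y, g y θ ^ c ∂μ := by
  have hnn : 0 ≤ fun y => g y θ ^ c := fun y => Real.rpow_nonneg (hg.nonneg θ hθ y) c
  rw [integral_pos_iff_support_of_nonneg hnn hint]
  by_contra h0
  have hz : μ (Function.support fun y => g y θ) = 0 := by
    refine measure_mono_null (fun y hy => ?_) (nonpos_iff_eq_zero.1 (not_lt.1 h0))
    exact (Real.rpow_pos_of_pos ((hg.nonneg θ hθ y).lt_of_ne' hy) c).ne'
  have h1 := hg.lintegral_eq_one θ hθ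
  rw [lintegral_eq_zero_iff (hg.measurable θ hθ).ennreal_ofReal |>.2] at h1
  · exact zero_ne_one h1
  · have : ∀ᵐ y ∂μ, y ∉ Function.support fun y => g y θ := measure_eq_zero_iff_ae_notMem.1 hz
    filter_upwards [this] with y hy
    rw [Function.notMem_support.1 hy]
    simp

/-- `V` as a power of the normalised density `g^(1+α) / ∫ g^(1+α)`. -/
theorem V_eq_of_ne_zero (hα : 0 ≤ α) (hα0 : α ≠ 0) {y : 𝒴} {θ : Param p} (hpos : 0 < g y θ)
    (hI : 0 < ∫ x, g x θ ^ (1 + α) ∂μ) :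
    V α μ g y θ = (g y θ ^ (1 + α)) ^ (α / (1 + α)) *
      (∫ x, g x θ ^ (1 + α) ∂μ) ^ (-(α / (1 + α))) := by
  rw [V, if_neg hα0, Real.rpow_neg hI.le, ← Real.rpow_mul hpos.le,
    mul_div_cancel₀ α (by positivity : (1 + α) ≠ 0), add_comm α 1, div_eq_mul_inv]

theorem hasPds_V (hα : 0 ≤ α) (hU : IsOpen U) {y : 𝒴} (hpos : ∀ θ ∈ U, 0 < g y θ)
    (hI : ∀ θ ∈ U, 0 < ∫ x, g x θ ^ (1 + α) ∂μ) {n : ℕ}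
    (hg : HasPds n (g y) U) (hIpd : HasPds n (fun θ => ∫ x, g x θ ^ (1 + α) ∂μ) U) :
    HasPds n (V α μ g y) U := by
  by_cases hα0 : α = 0
  · exact HasPds.congr hU (fun θ _ => by rw [V, if_pos hα0]) (HasPds.log hU hpos hg)
  · refine HasPds.congr hU (fun θ hθ => V_eq_of_ne_zero hα hα0 (hpos θ hθ) (hI θ hθ)) ?_
    exact HasPds.mul hU
      (HasPds.rpow hU (fun θ hθ => Real.rpow_pos_of_pos (hpos θ hθ) _)
        (HasPds.rpow hU hpos hg _) _) (HasPds.rpow hU hI hIpd _)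

theorem measurable_V {θ : Param p} (h : Measurable fun y => g y θ) :
    Measurable fun y => V α μ g y θ := by
  unfold V
  split_ifs
  · exact h.log
  · exact (h.pow_const _).div_const _

/-- Weighting by the density turns expectations into `μ`-integrals. As `g * (g ^ (1 + α)) ^ (α / (1
+ α) - 1) = 1`, only `g ^ (1 + α)` and its derivative remain, and `CondC3` governs both. -/
theorem mul_pd_V_eq_of_ne_zero (hα : 0 ≤ α) (hα0 : α ≠ 0) (hU : IsOpen U) (hθ₀ : θ₀ ∈ U) {y : 𝒴}
    (hpos : ∀ θ ∈ U, 0 < g y θ) (hI : ∀ θ ∈ U, 0 < ∫ x, g x θ ^ (1 + α) ∂μ)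
    {j : Fin p} (hpd : HasPd j (fun θ => g y θ ^ (1 + α)) θ₀)
    (hIpd : HasPd j (fun θ => ∫ x, g x θ ^ (1 + α) ∂μ) θ₀) :
    g y θ₀ * pd j (V α μ g y) θ₀ =
      α / (1 + α) * (∫ x, g x θ₀ ^ (1 + α) ∂μ) ^ (-(α / (1 + α))) *
        pd j (fun θ => g y θ ^ (1 + α)) θ₀ -
      α / (1 + α) * (∫ x, g x θ₀ ^ (1 + α) ∂μ) ^ (-(α / (1 + α)) - 1) *
        pd j (fun θ => ∫ x, g x θ ^ (1 + α) ∂μ) θ₀ * g y θ₀ ^ (1 + α) := by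
  have h0 := hpos θ₀ hθ₀
  have hh0 : 0 < g y θ₀ ^ (1 + α) := Real.rpow_pos_of_pos h0 _
  have hd := hasLineDerivAt_mul
    (hasLineDerivAt_comp (φ := fun t => t ^ (α / (1 + α)))
      (Real.hasDerivAt_rpow_const (Or.inl hh0.ne')) hpd.hasLineDerivAt)
    (hasLineDerivAt_comp (φ := fun t => t ^ (-(α / (1 + α))))
      (Real.hasDerivAt_rpow_const (Or.inl (hI θ₀ hθ₀).ne')) hIpd.hasLineDerivAt)
  rw [pd_congr (j := j) hU (fun θ hθ => V_eq_of_ne_zero hα hα0 (hpos θ hθ) (hI θ hθ)) hθ₀]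
  rw [show pd j (fun θ => (g y θ ^ (1 + α)) ^ (α / (1 + α)) *
      (∫ x, g x θ ^ (1 + α) ∂μ) ^ (-(α / (1 + α)))) θ₀ = _ from hd.lineDeriv]
  have hα1 : 1 + α ≠ 0 := by positivity
  have e1 : g y θ₀ * (g y θ₀ ^ (1 + α)) ^ (α / (1 + α) - 1) = 1 := by
    rw [← Real.rpow_mul h0.le, mul_sub, mul_div_cancel₀ α hα1]
    nth_rewrite 1 [← Real.rpow_one (g y θ₀)]
    rw [← Real.rpow_add h0]
    convert Real.rpow_zero (g y θ₀) using 2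
    ring
  have e2 : g y θ₀ * (g y θ₀ ^ (1 + α)) ^ (α / (1 + α)) = g y θ₀ ^ (1 + α) := by
    rw [← Real.rpow_mul h0.le, mul_div_cancel₀ α hα1, Real.rpow_add h0, Real.rpow_one]
  linear_combination
    (α / (1 + α) * (∫ x, g x θ₀ ^ (1 + α) ∂μ) ^ (-(α / (1 + α))) *
        pd j (fun θ => g y θ ^ (1 + α)) θ₀) * e1 -
      α / (1 + α) * (∫ x, g x θ₀ ^ (1 + α) ∂μ) ^ (-(α / (1 + α)) - 1) *
        pd j (fun θ => ∫ x, g x θ ^ (1 + α) ∂μ) θ₀ * e2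

theorem mul_pd_log_eq (hU : IsOpen U) (hθ₀ : θ₀ ∈ U) {y : 𝒴}
    (hpos : ∀ θ ∈ U, 0 < g y θ) {j : Fin p} (hpd : HasPd j (g y) θ₀) :
    g y θ₀ * pd j (V 0 μ g y) θ₀ = pd j (g y) θ₀ := by
  have h0 := hpos θ₀ hθ₀
  have hd := hasLineDerivAt_comp (Real.hasDerivAt_log h0.ne') hpd.hasLineDerivAt
  rw [pd_congr (j := j) hU (fun θ _ => by rw [V, if_pos rfl] : Set.EqOn (V 0 μ g y) _ U) hθ₀]
  rw [show pd j (fun θ => Real.log (g y θ)) θ₀ = _ from hd.lineDeriv]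
  field_simp

/-- The score has expectation zero. -/
theorem integral_pd_V_eq_zero (hα : 0 ≤ α) (hg : IsDensityFamily μ g Θ)
    (hsupp : ∀ θ ∈ Θ, Function.support (fun y => g y θ) = 𝒳) (hU : IsOpen U) (hUΘ : U ⊆ Θ)
    (hθ₀ : θ₀ ∈ U) {j : Fin p} (hpd : ∀ᵐ y ∂μ, y ∈ 𝒳 → HasPds 1 (g y) U)
    (hint : ∀ θ ∈ U, Integrable (fun y => g y θ ^ (1 + α)) μ)
    (hIpd : HasPd j (fun θ => ∫ x, g x θ ^ (1 + α) ∂μ) θ₀)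
    (hdint : Integrable (fun y => pd j (fun θ => g y θ ^ (1 + α)) θ₀) μ)
    (hd : pd j (fun θ => ∫ x, g x θ ^ (1 + α) ∂μ) θ₀ =
      ∫ y, pd j (fun θ => g y θ ^ (1 + α)) θ₀ ∂μ) :
    ∫ y, pd j (V α μ g y) θ₀ ∂(law μ g θ₀) = 0 := by
  have hI : ∀ θ ∈ U, 0 < ∫ x, g x θ ^ (1 + α) ∂μ := fun θ hθ =>
    integral_rpow_pos hg (hUΘ hθ) (hint θ hθ)
  have hoff : ∀ y ∉ 𝒳, ∀ θ ∈ U, g y θ ^ (1 + α) = 0 := fun y hy θ hθ => by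
    rw [eq_zero_of_notMem_support hsupp hy (hUΘ hθ), Real.zero_rpow (by positivity)]
  have hoffd : ∀ y ∉ 𝒳, pd j (fun θ => g y θ ^ (1 + α)) θ₀ = 0 := fun y hy => by
    rw [pd_congr (j := j) hU (hoff y hy) hθ₀]
    exact (hasLineDerivAt_const 0).lineDeriv
  rw [law, integral_withDensity_eq_integral_toReal_smul
    (hg.measurable θ₀ (hUΘ hθ₀)).ennreal_ofReal (Eventually.of_forall fun _ => ENNReal.ofReal_lt_top)]
  have hreal : ∀ y, (ENNReal.ofReal (g y θ₀)).toReal = g y θ₀ := fun y =>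
    ENNReal.toReal_ofReal (hg.nonneg θ₀ (hUΘ hθ₀) y)
  simp only [hreal, smul_eq_mul]
  by_cases hα0 : α = 0
  · subst hα0
    -- For `α = 0` the integral is the total mass, constantly one on `U`, so its derivative
    -- vanishes.
    have hI1 : Set.EqOn (fun θ => ∫ x, g x θ ^ (1 + (0 : ℝ)) ∂μ) (fun _ => 1) U := fun θ hθ => by
      simp only [add_zero, Real.rpow_one]
      rw [integral_eq_lintegral_of_nonneg_ae (Eventually.of_forall fun y => hg.nonneg θ (hUΘ hθ) y)
        (hg.measurable θ (hUΘ hθ)).aestronglyMeasurable, hg.lintegral_eq_one θ (hUΘ hθ)]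
      rfl
    rw [pd_congr hU hI1 hθ₀] at hd
    rw [show pd j (fun _ : Param p => (1 : ℝ)) θ₀ = 0 from
      (hasLineDerivAt_const 1).lineDeriv] at hd
    refine (integral_congr_ae ?_).trans hd.symm
    filter_upwards [hpd] with y hy
    by_cases hyX : y ∈ 𝒳
    · rw [mul_pd_log_eq hU hθ₀ (fun θ hθ => pos_of_mem_support hg hsupp hyX (hUΘ hθ))
        ((hy hyX j).1 θ₀ hθ₀)]
      simp only [add_zero, Real.rpow_one]
    · rw [hoffd y hyX, eq_zero_of_notMem_support hsupp hyX (hUΘ hθ₀), zero_mul]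
  · set c : ℝ := α / (1 + α) with hc
    set I₀ : ℝ := ∫ x, g x θ₀ ^ (1 + α) ∂μ with hI₀
    set D : ℝ := pd j (fun θ => ∫ x, g x θ ^ (1 + α) ∂μ) θ₀ with hD
    -- After integration the two terms become `c * I₀ ^ (-c) * D` and `c * I₀ ^ (-c - 1) * D * I₀`,
    -- which cancel.
    have heq : (fun y => g y θ₀ * pd j (V α μ g y) θ₀) =ᵐ[μ] fun y =>
        c * I₀ ^ (-c) * pd j (fun θ => g y θ ^ (1 + α)) θ₀ -
          c * I₀ ^ (-c - 1) * D * g y θ₀ ^ (1 + α) := by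
      filter_upwards [hpd] with y hy
      by_cases hyX : y ∈ 𝒳
      · have hpos : ∀ θ ∈ U, 0 < g y θ := fun θ hθ =>
          pos_of_mem_support hg hsupp hyX (hUΘ hθ)
        exact mul_pd_V_eq_of_ne_zero hα hα0 hU hθ₀ hpos hI
          ((HasPds.rpow hU hpos (hy hyX) (1 + α) j).1 θ₀ hθ₀) hIpd
      · rw [hoffd y hyX, hoff y hyX θ₀ hθ₀, eq_zero_of_notMem_support hsupp hyX (hUΘ hθ₀)]
        ring
    rw [integral_congr_ae heq, integral_sub (hdint.const_mul _) ((hint θ₀ hθ₀).const_mul _),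
      integral_const_mul, integral_const_mul, ← hd, ← hI₀,
      Real.rpow_sub_one (hI θ₀ hθ₀).ne']
    have := (hI θ₀ hθ₀).ne'
    field_simp
    ring

end SingleModel

end RenyiPD

/-! ### Averages of random functions with controlled derivatives. -/

namespace RenyiPD

variable {p : ℕ}

/-- Partial derivatives of a multiple of a sum. -/
theorem pd_const_mul_sum {ι : Type*} {s : Finset ι} {c : ℝ} {F : ι → Param p → ℝ}
    {U : Set (Param p)} {j : Fin p} (h : ∀ i ∈ s, ∀ θ ∈ U, HasPd j (F i) θ) :
    Set.EqOn (pd j fun θ => c * ∑ i ∈ s, F i θ) (fun θ => c * ∑ i ∈ s, pd j (F i) θ) U :=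
  fun θ hθ => (hasLineDerivAt_const_mul c
    (hasLineDerivAt_sum s fun i hi => (h i hi θ hθ).hasLineDerivAt)).lineDeriv

theorem HasPds.pd_pd_pd_const_mul_sum {ι : Type*} {s : Finset ι} {c : ℝ} {F : ι → Param p → ℝ}
    {U : Set (Param p)} (hU : IsOpen U) (h : ∀ i ∈ s, HasPds 3 (F i) U) (j k l : Fin p) :
    Set.EqOn (pd l fun θ => c * ∑ i ∈ s, F i θ) (fun θ => c * ∑ i ∈ s, pd l (F i) θ) U ∧
    Set.EqOn (pd k (pd l fun θ => c * ∑ i ∈ s, F i θ))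
      (fun θ => c * ∑ i ∈ s, pd k (pd l (F i)) θ) U ∧
    Set.EqOn (pd j (pd k (pd l fun θ => c * ∑ i ∈ s, F i θ)))
      (fun θ => c * ∑ i ∈ s, pd j (pd k (pd l (F i))) θ) U := by
  have h1 := pd_const_mul_sum (c := c) fun i hi => (h i hi l).1
  have h2 := (pd_congr (j := k) hU h1).trans
    (pd_const_mul_sum (c := c) fun i hi => ((h i hi l).2 k).1)
  exact ⟨h1, h2, (pd_congr (j := j) hU h2).trans
    (pd_const_mul_sum (c := c) fun i hi => (((h i hi l).2 k).2 j).1)⟩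

/-- Subtracting `lam₀` times the identity shifts the spectrum to the nonnegative reals and leaves a
positive semidefinite matrix. -/
theorem quadForm_ge_of_spectrum_ge {A : Matrix (Fin p) (Fin p) ℝ} (hA : A.IsHermitian) {lam₀ : ℝ}
    (h : ∀ lam ∈ spectrum ℝ A, lam₀ ≤ lam) (x : Param p) :
    lam₀ * ‖x‖ ^ 2 ≤ ∑ j, ∑ k, A j k * (x j * x k) := by
  have hpsd : (A - algebraMap ℝ _ lam₀).PosSemidef := by
    rw [Matrix.posSemidef_iff_isHermitian_and_spectrum_nonneg]
    refine ⟨hA.sub ?_, fun t ht => ?_⟩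
    · rw [Matrix.algebraMap_eq_diagonal]
      exact Matrix.isHermitian_diagonal _
    · rw [← spectrum.sub_singleton_eq] at ht
      obtain ⟨u, hu, v, hv, rfl⟩ := ht
      rw [Set.mem_singleton_iff] at hv
      have := h u hu
      show 0 ≤ u - v
      linarith
  have h1 := hpsd.dotProduct_mulVec_nonneg (fun i => x i)
  rw [Matrix.sub_mulVec, dotProduct_sub, sub_nonneg, Matrix.algebraMap_eq_diagonal] at h1
  refine (le_of_eq ?_).trans (h1.trans (le_of_eq ?_))
  · rw [EuclideanSpace.norm_sq_eq, Finset.mul_sum]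
    simp only [dotProduct, Matrix.mulVec_diagonal]
    refine Finset.sum_congr rfl fun i _ => ?_
    simp; ring
  · simp only [dotProduct, Matrix.mulVec, Finset.mul_sum]
    refine Finset.sum_congr rfl fun i _ => Finset.sum_congr rfl fun k _ => ?_
    simp; ring

/-- A measurable set on which the functions `v y` have three partial derivatives on `U`, those of
order three bounded by `M y`, and on which the derivatives are measurable in `y`. -/
structure GoodSet {𝒴 : Type*} [MeasurableSpace 𝒴] (v : 𝒴 → Param p → ℝ) (U : Set (Param p))
    (M : 𝒴 → ℝ) (G : Set 𝒴) : Prop where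
  meas : MeasurableSet G
  nonneg : ∀ y ∈ G, 0 ≤ M y
  hasPds : ∀ y ∈ G, HasPds 3 (v y) U
  bound : ∀ y ∈ G, ∀ θ ∈ U, ∀ j k l, |pd j (pd k (pd l (v y))) θ| ≤ M y
  meas_pd : ∀ θ ∈ U, ∀ l, Measurable (G.indicator fun y => pd l (v y) θ)
  meas_pd_pd : ∀ θ ∈ U, ∀ k l, Measurable (G.indicator fun y => pd k (pd l (v y)) θ)

section Model

variable {𝒴 : Type*} [MeasurableSpace 𝒴] {μ : Measure 𝒴} {g : 𝒴 → Param p → ℝ}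
  {Θ U : Set (Param p)} {𝒳 : Set 𝒴} {α : ℝ} {θ₀ : Param p}

/-- The exceptional set need not be measurable, so a measurable null set covering it is removed from
`𝒳`. The law charges neither this null set nor the complement of `𝒳`. -/
theorem exists_goodSet (hα : 0 ≤ α) (hg : IsDensityFamily μ g Θ)
    (hsupp : ∀ θ ∈ Θ, Function.support (fun y => g y θ) = 𝒳) (hU : IsOpen U) (hUΘ : U ⊆ Θ)
    (hθ₀ : θ₀ ∈ U) (hpd : ∀ᵐ y ∂μ, y ∈ 𝒳 → ThricePd (g y) U)
    (hint : ∀ θ ∈ U, Integrable (fun y => g y θ ^ (1 + α)) μ)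
    (hIpd : ThricePd (fun θ => ∫ x, g x θ ^ (1 + α) ∂μ) U)
    {M : Fin p → Fin p → Fin p → 𝒴 → ℝ}
    (hM : ∀ j k l, ∀ᵐ y ∂μ, y ∈ 𝒳 → ∀ θ ∈ U, |pd j (pd k (pd l (V α μ g y))) θ| ≤ M j k l y) :
    ∃ G, GoodSet (V α μ g) U (fun y => ∑ j, ∑ k, ∑ l, M j k l y) G ∧
      ∀ᵐ y ∂(law μ g θ₀), y ∈ G := by
  have hae : ∀ᵐ y ∂μ, y ∈ 𝒳 → (ThricePd (g y) U ∧
      ∀ j k l, ∀ θ ∈ U, |pd j (pd k (pd l (V α μ g y))) θ| ≤ M j k l y) := by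
    filter_upwards [hpd, ae_all_iff.2 fun j => ae_all_iff.2 fun k => ae_all_iff.2 fun l => hM j k l]
      with y h1 h2 hy
    exact ⟨h1 hy, fun j k l => h2 j k l hy⟩
  set N := toMeasurable μ {y | ¬ (y ∈ 𝒳 → (ThricePd (g y) U ∧
      ∀ j k l, ∀ θ ∈ U, |pd j (pd k (pd l (V α μ g y))) θ| ≤ M j k l y))} with hN
  have hN0 : μ N = 0 := by rw [hN, measure_toMeasurable]; exact hae
  have h𝒳 : MeasurableSet 𝒳 := by
    rw [← hsupp θ₀ (hUΘ hθ₀)]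
    exact measurableSet_support (hg.measurable θ₀ (hUΘ hθ₀))
  have hG : ∀ y ∈ 𝒳 \ N, ThricePd (g y) U ∧
      ∀ j k l, ∀ θ ∈ U, |pd j (pd k (pd l (V α μ g y))) θ| ≤ M j k l y := by
    intro y hy
    by_contra hcon
    exact hy.2 (subset_toMeasurable _ _ fun h => hcon (h hy.1))
  have hGm : MeasurableSet (𝒳 \ N) := h𝒳.diff (measurableSet_toMeasurable _ _)
  have hV : ∀ y ∈ 𝒳 \ N, HasPds 3 (V α μ g y) U := fun y hy =>
    hasPds_V hα hU (fun θ hθ => pos_of_mem_support hg hsupp hy.1 (hUΘ hθ))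
      (fun θ hθ => integral_rpow_pos hg (hUΘ hθ) (hint θ hθ)) (hG y hy).1.hasPds hIpd.hasPds
  have hm1 : ∀ θ ∈ U, ∀ l, Measurable ((𝒳 \ N).indicator fun y => pd l (V α μ g y) θ) :=
    fun θ hθ l => measurable_indicator_pd hU
      (fun θ hθ => (measurable_V (hg.measurable θ (hUΘ hθ))).indicator hGm)
      (fun y hy => (hV y hy l).1) hθ
  have hnn : ∀ y ∈ 𝒳 \ N, ∀ j k l, 0 ≤ M j k l y := fun y hy j k l =>
    (abs_nonneg _).trans ((hG y hy).2 j k l θ₀ hθ₀)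
  refine ⟨𝒳 \ N, ⟨hGm, fun y hy => Finset.sum_nonneg fun j _ => Finset.sum_nonneg fun k _ =>
    Finset.sum_nonneg fun l _ => hnn y hy j k l, hV, fun y hy θ hθ j k l => ?_, hm1, fun θ hθ k l => ?_⟩, ?_⟩
  · have hnn := hnn y hy
    refine ((hG y hy).2 j k l θ hθ).trans ?_
    calc M j k l y ≤ ∑ l, M j k l y :=
          Finset.single_le_sum (f := fun l => M j k l y) (fun l _ => hnn j k l) (Finset.mem_univ l)
      _ ≤ ∑ k, ∑ l, M j k l y :=
          Finset.single_le_sum (f := fun k => ∑ l, M j k l y)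
            (fun k _ => Finset.sum_nonneg fun l _ => hnn j k l) (Finset.mem_univ k)
      _ ≤ ∑ j, ∑ k, ∑ l, M j k l y :=
          Finset.single_le_sum (f := fun j => ∑ k, ∑ l, M j k l y)
            (fun j _ => Finset.sum_nonneg fun k _ => Finset.sum_nonneg fun l _ => hnn j k l)
            (Finset.mem_univ j)
  · exact measurable_indicator_pd hU (fun θ hθ => hm1 θ hθ l)
      (fun y hy => ((hV y hy l).2 k).1) hθ
  · refine ae_law_of_ae hg (hUΘ hθ₀) hsupp ?_
    filter_upwards [measure_eq_zero_iff_ae_notMem.1 hN0] with y hy hyX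
    exact ⟨hyX, hy⟩

end Model

section Estimator

variable {𝒴 : Type*} [MeasurableSpace 𝒴] {v : ℕ → 𝒴 → Param p → ℝ}
  {U : Set (Param p)} {M : ℕ → 𝒴 → ℝ} {G : ℕ → Set 𝒴} {θ₀ : Param p}

/-- The average of `v i (y i)` over the first `n` observations. -/
noncomputable def avg (v : ℕ → 𝒴 → Param p → ℝ) (n : ℕ) (y : Fin n → 𝒴) (θ : Param p) : ℝ :=
  1 / (n : ℝ) * ∑ i : Fin n, v i (y i) θ

theorem hasPds_avg (hU : IsOpen U) (hG : ∀ i, GoodSet (v i) U (M i) (G i)) {n : ℕ} {y : Fin n → 𝒴}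
    (hy : ∀ i : Fin n, y i ∈ G i) : HasPds 3 (avg v n y) U :=
  HasPds.const_mul hU _ (HasPds.sum hU _ fun i _ => (hG i).hasPds _ (hy i))

theorem pd_avg (hU : IsOpen U) (hG : ∀ i, GoodSet (v i) U (M i) (G i)) {n : ℕ} {y : Fin n → 𝒴}
    (hy : ∀ i : Fin n, y i ∈ G i) (j k l : Fin p) {θ : Param p} (hθ : θ ∈ U) :
    pd l (avg v n y) θ = 1 / (n : ℝ) * ∑ i : Fin n, pd l (v i (y i)) θ ∧
    pd k (pd l (avg v n y)) θ = 1 / (n : ℝ) * ∑ i : Fin n, pd k (pd l (v i (y i))) θ ∧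
    |pd j (pd k (pd l (avg v n y))) θ| ≤ 1 / (n : ℝ) * ∑ i : Fin n, M i (y i) := by
  obtain ⟨h1, h2, h3⟩ := HasPds.pd_pd_pd_const_mul_sum (s := Finset.univ) (c := 1 / (n : ℝ))
    (F := fun i : Fin n => v i (y i)) hU (fun i _ => (hG i).hasPds _ (hy i)) j k l
  refine ⟨h1 hθ, h2 hθ, ?_⟩
  rw [show pd j (pd k (pd l (avg v n y))) θ = _ from h3 hθ, abs_mul,
    abs_of_nonneg (by positivity : (0 : ℝ) ≤ 1 / n)]
  exact mul_le_mul_of_nonneg_left ((Finset.abs_sum_le_sum_abs _ _).trans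
    (Finset.sum_le_sum fun i _ => (hG i).bound _ (hy i) θ hθ j k l)) (by positivity)

theorem continuousOn_avg (hU : IsOpen U) (hG : ∀ i, GoodSet (v i) U (M i) (G i)) {n : ℕ}
    {y : Fin n → 𝒴} (hy : ∀ i : Fin n, y i ∈ G i) {r : ℝ} (hr : Metric.ball θ₀ r ⊆ U) :
    ContinuousOn (avg v n y) (Metric.ball θ₀ r) ∧
      ∀ l, ContinuousOn (pd l (avg v n y)) (Metric.ball θ₀ r) := by
  refine HasPds.continuousOn_ball (C := 1 / (n : ℝ) * ∑ i : Fin n, M i (y i)) ?_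
    fun x hx j k l => (pd_avg hU hG hy j k l (hr hx)).2.2
  have h' := hasPds_avg hU hG hy
  exact fun l => ⟨fun x hx => (h' l).1 x (hr hx), fun k =>
    ⟨fun x hx => ((h' l).2 k).1 x (hr hx), fun j =>
      ⟨fun x hx => (((h' l).2 k).2 j).1 x (hr hx), trivial⟩⟩⟩

/-- A measurable choice of the critical point of the average that is closest to `θ₀`. -/
theorem exists_measurable_nearest_critical (hU : IsOpen U)
    (hG : ∀ i, GoodSet (v i) U (M i) (G i)) {r : ℝ} (hr : 0 < r)
    (hrU : Metric.ball θ₀ (2 * r) ⊆ U) (n : ℕ) :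
    ∃ T : (Fin n → 𝒴) → Param p, Measurable T ∧ (∀ y, T y ∈ Metric.closedBall θ₀ r) ∧
      ∀ y, (∀ i : Fin n, y i ∈ G i) → ∀ η ∈ Metric.closedBall θ₀ r,
        (∀ l, pd l (avg v n y) η = 0) →
          (∀ l, pd l (avg v n y) (T y) = 0) ∧ ‖T y - θ₀‖ ≤ ‖η - θ₀‖ := by
  classical
  have hsub : Metric.closedBall θ₀ r ⊆ Metric.ball θ₀ (2 * r) :=
    Metric.closedBall_subset_ball (by linarith)
  set A : Set (Fin n → 𝒴) := {y | ∀ i : Fin n, y i ∈ G i} with hA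
  have hAm : MeasurableSet A := by
    rw [hA, Set.ofPred_forall]
    exact MeasurableSet.iInter fun i => (hG i).meas.preimage (measurable_pi_apply i)
  -- The zeros of this function are the critical points; the value `1` off `A` keeps it continuous
  -- in `θ` and measurable in `y` without creating zeros.
  have hmeas : ∀ θ ∈ Metric.closedBall θ₀ r, Measurable fun y : Fin n → 𝒴 =>
      if y ∈ A then ∑ l, |pd l (avg v n y) θ| else 1 := by
    intro θ hθ
    have heq : (fun y : Fin n → 𝒴 => if y ∈ A then ∑ l, |pd l (avg v n y) θ| else 1) =
        fun y => if y ∈ A then ∑ l, |1 / (n : ℝ) * ∑ i : Fin n,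
          (G i).indicator (fun y => pd l (v i y) θ) (y i)| else 1 := by
      funext y
      by_cases hy : y ∈ A
      · simp only [hy, if_true]
        refine Finset.sum_congr rfl fun l _ => ?_
        rw [(pd_avg hU hG hy l l l (hrU (hsub hθ))).1]
        congr 2
        exact Finset.sum_congr rfl fun i _ => (Set.indicator_of_mem (hy i) fun z => pd l (v i z) θ).symm
      · simp [hy]
    rw [heq]
    refine Measurable.ite hAm (Finset.measurable_sum _ fun l _ => Measurable.abs ?_)
      measurable_const
    exact measurable_const.mul (Finset.measurable_sum _ fun i _ =>
      ((hG i).meas_pd θ (hrU (hsub hθ)) l).comp (measurable_pi_apply i))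
  have hcont : ∀ y : Fin n → 𝒴, ContinuousOn
      (fun θ => if y ∈ A then ∑ l, |pd l (avg v n y) θ| else 1) (Metric.closedBall θ₀ r) := by
    intro y
    by_cases hy : y ∈ A
    · simp only [hy, if_true]
      exact continuousOn_finsetSum _ fun l _ =>
        (((continuousOn_avg hU hG hy hrU).2 l).mono hsub).abs
    · simp only [hy, if_false]
      exact continuousOn_const
  have hnn : ∀ y : Fin n → 𝒴, ∀ θ ∈ Metric.closedBall θ₀ r,
      0 ≤ if y ∈ A then ∑ l, |pd l (avg v n y) θ| else 1 := by
    intro y θ _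
    split_ifs
    · exact Finset.sum_nonneg fun _ _ => abs_nonneg _
    · exact zero_le_one
  obtain ⟨T, hT, hTK, hT0⟩ := exists_measurable_nearest_zero (isCompact_closedBall θ₀ r)
    (Metric.mem_closedBall_self hr.le) hcont hmeas hnn
  refine ⟨T, hT, hTK, fun y hy η hη h0 => ?_⟩
  have hyA : y ∈ A := hy
  obtain ⟨h1, h2⟩ := hT0 y η hη (by simp [hyA, h0])
  refine ⟨fun l => ?_, h2⟩
  simp only [hyA, if_true] at h1
  exact abs_eq_zero.1 ((Finset.sum_eq_zero_iff_of_nonneg fun _ _ => abs_nonneg _).1 h1 l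
    (Finset.mem_univ l))

/-- A sufficient condition for a critical point of the average close to `θ₀`. -/
theorem exists_critical_of_small (hU : IsOpen U) (hG : ∀ i, GoodSet (v i) U (M i) (G i)) {r : ℝ}
    (hrU : Metric.ball θ₀ (2 * r) ⊆ U) {n : ℕ} {y : Fin n → 𝒴}
    (hy : ∀ i : Fin n, y i ∈ G i) {A : Matrix (Fin p) (Fin p) ℝ} {lam a : ℝ} (hlam : 0 < lam)
    (ha : 0 < a) (har : a ≤ r) (hasmall : a * (p + p ^ 2) ≤ lam / 8) (hA : A.IsSymm)
    (hquad : ∀ h : Param p, lam * ‖h‖ ^ 2 ≤ ∑ j, ∑ k, A j k * (h j * h k))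
    (h₁ : ∀ l, |1 / (n : ℝ) * ∑ i : Fin n, pd l (v i (y i)) θ₀| ≤ a ^ 2)
    (h₂ : ∀ k l, |1 / (n : ℝ) * ∑ i : Fin n, pd k (pd l (v i (y i))) θ₀ + A l k| ≤ a)
    (h₃ : 1 / (n : ℝ) * ∑ i : Fin n, M i (y i) ≤ lam / (8 * (p ^ 3 + 1) * a)) :
    ∃ x ∈ Metric.closedBall θ₀ a, ∀ l, pd l (avg v n y) x = 0 := by
  have hsub : Metric.closedBall θ₀ a ⊆ Metric.ball θ₀ (2 * r) :=
    Metric.closedBall_subset_ball (by linarith)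
  have hθ₀ : θ₀ ∈ U := hrU (hsub (Metric.mem_closedBall_self ha.le))
  have hP := hasPds_avg hU hG hy
  refine exists_pd_eq_zero_of_close (K := lam / (8 * (p ^ 3 + 1) * a)) ha
    ((continuousOn_avg hU hG hy hrU).1.mono hsub)
    (fun x hx j k l => ?_) hA hquad (fun l => ?_) (fun k l => ?_) ?_ (ε₁ := a ^ 2) (ε₂ := a)
  · have hx' := hrU (hsub hx)
    exact ⟨(hP l).1 x hx', ((hP l).2 k).1 x hx', (((hP l).2 k).2 j).1 x hx',
      (pd_avg hU hG hy j k l hx').2.2.trans h₃⟩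
  · rw [(pd_avg hU hG hy l l l hθ₀).1]; exact h₁ l
  · rw [(pd_avg hU hG hy l k l hθ₀).2.1]; exact h₂ k l
  · have h4 : (p : ℝ) ^ 3 * (a * (lam / (8 * (p ^ 3 + 1) * a))) ≤ lam / 8 := by
      rw [show (p : ℝ) ^ 3 * (a * (lam / (8 * (p ^ 3 + 1) * a))) =
        lam / 8 * (p ^ 3 / (p ^ 3 + 1)) by field_simp]
      refine mul_le_of_le_one_right (by positivity) ?_
      rw [div_le_one (by positivity)]
      linarith
    have h5 : p * a * (a ^ 2 + p * a * (a + p * a * (lam / (8 * (p ^ 3 + 1) * a)))) =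
        a ^ 2 * (a * (p + p ^ 2) + p ^ 3 * (a * (lam / (8 * (p ^ 3 + 1) * a)))) := by ring
    rw [h5, mul_comm (lam / 2)]
    exact mul_lt_mul_of_pos_left (by linarith) (by positivity)

end Estimator

end RenyiPD

/-! ### Consistency of the nearest critical point. -/

namespace RenyiPD

section Consistency

variable {p : ℕ} {𝒴 : Type*} [MeasurableSpace 𝒴] {v : ℕ → 𝒴 → Param p → ℝ}
  {U : Set (Param p)} {M : ℕ → 𝒴 → ℝ} {G : ℕ → Set 𝒴} {θ₀ : Param p}
  {Ω : Type*} [MeasurableSpace Ω] {P : Measure Ω} {Y : ℕ → Ω → 𝒴}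

/-- Markov's inequality for a sum of random variables with a common mean. -/
theorem measureReal_sum_ge_le (hY : ∀ i, Measurable (Y i))
    (hMnn : ∀ i, ∀ᵐ ω ∂P, 0 ≤ M i (Y i ω)) {m : ℝ} (hM : ∀ i, Integrable (M i) (P.map (Y i)))
    (hm : ∀ i, ∫ y, M i y ∂(P.map (Y i)) = m) {K : ℝ} (hK : 0 < K) {n : ℕ} (hn : 0 < n) :
    P.real {ω | K * n ≤ ∑ i ∈ Finset.range n, M i (Y i ω)} ≤ m / K := by
  have hn' : (0 : ℝ) < n := by exact_mod_cast hn
  have hint : ∀ i, Integrable (fun ω => M i (Y i ω)) P := fun i => (hM i).comp_measurable (hY i)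
  have h := mul_meas_ge_le_integral_of_nonneg (μ := P)
    (f := fun ω => ∑ i ∈ Finset.range n, M i (Y i ω))
    (by
      filter_upwards [ae_all_iff.2 hMnn] with ω hω
      exact Finset.sum_nonneg fun i _ => hω i)
    (integrable_finsetSum _ fun i _ => hint i) (K * n)
  rw [integral_finsetSum _ fun i _ => hint i] at h
  have hE : ∀ i, ∫ ω, M i (Y i ω) ∂P = m := fun i => by
    rw [← hm i, integral_map (hY i).aemeasurable (hM i).aestronglyMeasurable]
  simp only [hE, Finset.sum_const, Finset.card_range, nsmul_eq_mul] at h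
  rw [le_div_iff₀ hK]
  rw [← mul_le_mul_iff_of_pos_left hn']
  linarith

/-- Consistency of the critical points of averages of independent random functions. -/
theorem exists_consistent_critical [IsProbabilityMeasure P] (hU : IsOpen U) (hG : ∀ i, GoodSet (v i) U (M i) (G i)) {r : ℝ}
    (hr : 0 < r) (hrU : Metric.ball θ₀ (2 * r) ⊆ U) (hY : ∀ i, Measurable (Y i))
    (hindep : iIndepFun Y P) (hYG : ∀ i, ∀ᵐ ω ∂P, Y i ω ∈ G i)
    (hUI₁ : ∀ l, CesaroUI (fun i => P.map (Y i))
      fun i => (G i).indicator fun y => pd l (v i y) θ₀)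
    (hUI₂ : ∀ k l, CesaroUI (fun i => P.map (Y i))
      fun i => (G i).indicator fun y => pd k (pd l (v i y)) θ₀)
    (hE₁ : ∀ i l, ∫ y, (G i).indicator (fun y => pd l (v i y) θ₀) y ∂(P.map (Y i)) = 0)
    {A : ℕ → Matrix (Fin p) (Fin p) ℝ} {lam : ℝ} (hlam : 0 < lam)
    (hA : ∀ n, (A n).IsSymm)
    (hquad : ∀ n : ℕ, 1 ≤ n → ∀ h : Param p,
      lam * ‖h‖ ^ 2 ≤ ∑ j, ∑ k, A n j k * (h j * h k))
    (hE₂ : ∀ (n : ℕ) (k l), A n l k = -(1 / (n : ℝ) * ∑ i ∈ Finset.range n,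
      ∫ y, (G i).indicator (fun y => pd k (pd l (v i y)) θ₀) y ∂(P.map (Y i))))
    {m : ℝ} (hM : ∀ i, Integrable (M i) (P.map (Y i)))
    (hm : ∀ i, ∫ y, M i y ∂(P.map (Y i)) = m) :
    ∃ T : (n : ℕ) → (Fin n → 𝒴) → Param p, (∀ n, Measurable (T n)) ∧
      (∀ n y, T n y ∈ Metric.closedBall θ₀ r) ∧ ∀ a : ℝ, 0 < a →
      Tendsto (fun n : ℕ => P {ω | ¬ ((∀ l, pd l (avg v n fun i : Fin n => Y i ω)
        (T n fun i : Fin n => Y i ω) = 0) ∧ ‖(T n fun i : Fin n => Y i ω) - θ₀‖ ≤ a)})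
        atTop (𝓝 0) := by
  have hθ₀ : θ₀ ∈ U := hrU (Metric.mem_ball_self (by linarith))
  choose T hT hTr hT0 using fun n => exists_measurable_nearest_critical (θ₀ := θ₀) hU hG hr hrU n
  refine ⟨T, hT, hTr, ?_⟩
  set bad : ℝ → ℕ → Set Ω := fun a n => {ω | ¬ ((∀ l, pd l (avg v n fun i : Fin n => Y i ω)
        (T n fun i : Fin n => Y i ω) = 0) ∧ ‖(T n fun i : Fin n => Y i ω) - θ₀‖ ≤ a)} with hbad
  have hMnn : ∀ i, ∀ᵐ ω ∂P, 0 ≤ M i (Y i ω) := fun i => by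
    filter_upwards [hYG i] with ω hω using (hG i).nonneg _ hω
  have hm0 : 0 ≤ m := by
    rw [← hm 0, integral_map (hY 0).aemeasurable (hM 0).aestronglyMeasurable]
    exact integral_nonneg_of_ae (hMnn 0)
  have hYG' : ∀ᵐ ω ∂P, ∀ i, Y i ω ∈ G i := ae_all_iff.2 hYG
  -- With the threshold `lam / (8 * (p ^ 3 + 1) * a)` for the averaged third-derivative bound,
  -- Markov's inequality gives exactly `C * a`.
  set C : ℝ := m * (8 * (p ^ 3 + 1)) / lam with hC
  have hC0 : 0 ≤ C := by positivity
  have key : ∀ a, 0 < a → a ≤ r → a * (p + p ^ 2) ≤ lam / 8 → ∀ δ, 0 < δ →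
      ∀ᶠ n in atTop, P.real (bad a n) ≤ δ + C * a := by
    intro a ha har hasmall δ hδ
    set S : ℕ → Fin p → Set Ω := fun n l => {ω | a ^ 2 * n ≤ |∑ i ∈ Finset.range n,
      ((G i).indicator (fun y => pd l (v i y) θ₀) (Y i ω) -
        ∫ y, (G i).indicator (fun y => pd l (v i y) θ₀) y ∂(P.map (Y i)))|} with hS
    set D : ℕ → Fin p → Fin p → Set Ω := fun n k l => {ω | a * n ≤ |∑ i ∈ Finset.range n,
      ((G i).indicator (fun y => pd k (pd l (v i y)) θ₀) (Y i ω) -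
        ∫ y, (G i).indicator (fun y => pd k (pd l (v i y)) θ₀) y ∂(P.map (Y i)))|} with hD
    have hlim : Tendsto (fun n => ∑ l, P.real (S n l) + ∑ k, ∑ l, P.real (D n k l))
        atTop (𝓝 0) := by
      have h1 : Tendsto (fun n => ∑ l, P.real (S n l)) atTop (𝓝 (∑ _l : Fin p, 0)) :=
        tendsto_finsetSum _ fun l _ => tendsto_measureReal_abs_sum_sub_ge hY hindep
          (fun i => (hG i).meas_pd θ₀ hθ₀ l) (hUI₁ l) (by positivity)
      have h2 : Tendsto (fun n => ∑ k, ∑ l, P.real (D n k l)) atTop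
          (𝓝 (∑ _k : Fin p, ∑ _l : Fin p, 0)) :=
        tendsto_finsetSum _ fun k _ => tendsto_finsetSum _ fun l _ =>
          tendsto_measureReal_abs_sum_sub_ge hY hindep
            (fun i => (hG i).meas_pd_pd θ₀ hθ₀ k l) (hUI₂ k l) ha
      simpa using h1.add h2
    filter_upwards [hlim.eventually (gt_mem_nhds hδ), eventually_ge_atTop 1] with n hn hn1
    have hn' : (0 : ℝ) < n := by exact_mod_cast hn1
    have hK : 0 < lam / (8 * ((p : ℝ) ^ 3 + 1) * a) := by positivity
    set B : Set Ω := {ω | lam / (8 * ((p : ℝ) ^ 3 + 1) * a) * n ≤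
      ∑ i ∈ Finset.range n, M i (Y i ω)} with hB
    have hBle : P.real B ≤ C * a := by
      refine (measureReal_sum_ge_le hY hMnn hM hm hK hn1).trans_eq ?_
      rw [hC]
      field_simp
    have hsub : bad a n ⊆ ({ω | ¬ ∀ i, Y i ω ∈ G i} ∪ B) ∪
        ((⋃ l, S n l) ∪ ⋃ k, ⋃ l, D n k l) := by
      intro ω hω
      by_contra hcon
      simp only [Set.mem_union, Set.mem_iUnion, not_or, not_exists, Set.mem_ofPred_eq, not_not,
        hB, hS, hD, not_le] at hcon
      obtain ⟨⟨hωG, hωB⟩, hωS, hωD⟩ := hcon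
      refine hω ?_
      have hyG : ∀ i : Fin n, Y i ω ∈ G i := fun i => hωG i
      suffices h : ∃ x ∈ Metric.closedBall θ₀ a,
          ∀ l, pd l (avg v n fun i : Fin n => Y i ω) x = 0 by
        obtain ⟨x, hx, hx0⟩ := h
        obtain ⟨h1, h2⟩ := hT0 n _ hyG x (Metric.closedBall_subset_closedBall har hx) hx0
        exact ⟨h1, h2.trans (mem_closedBall_iff_norm.1 hx)⟩
      refine exists_critical_of_small hU hG hrU hyG hlam ha har hasmall (hA n)
        (hquad n hn1) (fun l => ?_) (fun k l => ?_) ?_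
      · have := hωS l
        simp only [hE₁, sub_zero, Set.indicator_of_mem (hωG _)] at this
        rw [Fin.sum_univ_eq_sum_range (fun i => pd l (v i (Y i ω)) θ₀) n, abs_mul,
          abs_of_pos (by positivity : (0 : ℝ) < 1 / n), one_div, inv_mul_le_iff₀ hn', mul_comm]
        exact this.le
      · have := hωD k l
        simp only [Set.indicator_of_mem (hωG _), Finset.sum_sub_distrib] at this
        rw [Fin.sum_univ_eq_sum_range (fun i => pd k (pd l (v i (Y i ω))) θ₀) n, hE₂ n k l,
          ← sub_eq_add_neg, ← mul_sub, abs_mul,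
          abs_of_pos (by positivity : (0 : ℝ) < 1 / n), one_div, inv_mul_le_iff₀ hn', mul_comm]
        exact this.le
      · rw [Fin.sum_univ_eq_sum_range (fun i => M i (Y i ω)) n, one_div, inv_mul_le_iff₀ hn',
          mul_comm]
        exact hωB.le
    have hnull : P.real {ω | ¬ ∀ i, Y i ω ∈ G i} = 0 := by
      rw [measureReal_def, show P {ω | ¬ ∀ i, Y i ω ∈ G i} = 0 from hYG', ENNReal.toReal_zero]
    calc P.real (bad a n)
        ≤ (P.real {ω | ¬ ∀ i, Y i ω ∈ G i} + P.real B) +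
          (∑ l, P.real (S n l) + ∑ k, ∑ l, P.real (D n k l)) := by
          refine (measureReal_mono hsub (measure_ne_top _ _)).trans
            ((measureReal_union_le _ _).trans (add_le_add (measureReal_union_le _ _)
              ((measureReal_union_le _ _).trans (add_le_add (measureReal_iUnion_fintype_le _) ?_))))
          exact (measureReal_iUnion_fintype_le _).trans
            (Finset.sum_le_sum fun k _ => measureReal_iUnion_fintype_le _)
      _ ≤ δ + C * a := by rw [hnull]; linarith
  intro a₀ ha₀
  have hreal : Tendsto (fun n => P.real (bad a₀ n)) atTop (𝓝 0) := by
    rw [Metric.tendsto_atTop']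
    intro ε hε
    -- The radius also depends on the tolerance `ε`: it makes the Markov cost `C * a` at most `ε /
    -- 4`, while `key` is applied with `δ = ε / 2`.
    set a : ℝ := min (min a₀ r) (min (lam / 8 / (p + p ^ 2 + 1)) (ε / 4 / (C + 1))) with ha
    have ha0 : 0 < a := by
      have : (0 : ℝ) < p + p ^ 2 + 1 := by positivity
      positivity
    have h1 : a ≤ a₀ := (min_le_left _ _).trans (min_le_left _ _)
    have h2 : a ≤ r := (min_le_left _ _).trans (min_le_right _ _)
    have h3 : a * (p + p ^ 2 + 1) ≤ lam / 8 :=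
      (le_div_iff₀ (by positivity)).1 ((min_le_right _ _).trans (min_le_left _ _))
    have h4 : a * (C + 1) ≤ ε / 4 :=
      (le_div_iff₀ (by positivity)).1 ((min_le_right _ _).trans (min_le_right _ _))
    obtain ⟨n₀, hn₀⟩ := eventually_atTop.1 (key a ha0 h2 (by linarith) (ε / 2) (half_pos hε))
    refine ⟨n₀, fun n hn => ?_⟩
    rw [Real.dist_eq, sub_zero, abs_of_nonneg measureReal_nonneg]
    -- `T` does not depend on the radius, so the bad event only grows when the radius shrinks.
    have hmono : P.real (bad a₀ n) ≤ P.real (bad a n) := by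
      refine measureReal_mono (fun ω hω h => hω ⟨h.1, h.2.trans h1⟩) (measure_ne_top _ _)
    have := hn₀ n hn.le
    linarith
  exact (ENNReal.tendsto_toReal_zero_iff fun n => measure_ne_top _ _).1 hreal

end Consistency

section Model

variable {p : ℕ} {𝒴 : Type*} [MeasurableSpace 𝒴] {μ : Measure 𝒴} {f : ℕ → 𝒴 → Param p → ℝ}
  {α : ℝ} {θ₀ : Param p}

theorem Psi_apply (n : ℕ) (j k : Fin p) :
    Psi α μ f θ₀ n j k = -(1 / (n : ℝ) * ∑ i ∈ Finset.range n,
      ∫ y, pd j (pd k (V α μ (f i) y)) θ₀ ∂(law μ (f i) θ₀)) := by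
  simp [Psi, J, Matrix.sum_apply]

theorem isHermitian_Psi (h : ∀ i, (J α μ (f i) θ₀).PosDef) (n : ℕ) :
    (Psi α μ f θ₀ n).IsHermitian := by
  ext j k
  have hJ : ∀ i, J α μ (f i) θ₀ k j = J α μ (f i) θ₀ j k := fun i => by
    simpa using (h i).1.apply j k
  simp [Psi, Matrix.sum_apply, hJ]

end Model

end RenyiPD

/-! ### Assembly of the main theorem. -/

theorem theorem1 {p : ℕ} {𝒴 : Type*} [MeasurableSpace 𝒴] (μ : Measure 𝒴)
    {Ω : Type*} [MeasurableSpace Ω] (P : Measure Ω) [IsProbabilityMeasure P]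
    (α : ℝ) (hα : 0 ≤ α)
    (Θ : Set (Param p)) (f : ℕ → 𝒴 → Param p → ℝ) (hf : ∀ i, IsDensityFamily μ (f i) Θ)
    (θ₀ : Param p) (hθ₀ : θ₀ ∈ Θ)
    (Y : ℕ → Ω → 𝒴) (hY : ∀ i, Measurable (Y i)) (hindep : iIndepFun Y P)
    (hlaw : ∀ i, P.map (Y i) = law μ (f i) θ₀)
    (𝒳 : Set 𝒴) (U : Set (Param p))
    (hC1 : CondC1 f Θ 𝒳) (hC2 : CondC2 μ f Θ 𝒳 U θ₀) (hC3 : CondC3 α μ f U)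
    (hC4 : CondC4 α μ f θ₀) (hC5 : CondC5 α μ f 𝒳 U θ₀) (hC6 : CondC6 α μ f θ₀) :
    ∃ T : (n : ℕ) → (Fin n → 𝒴) → Param p,
      (∀ n, Measurable (T n)) ∧ (∀ n y, T n y ∈ Θ) ∧
      Tendsto (fun n : ℕ => P {ω | ¬ SolvesEstimatingEquations α μ f n
        (fun i : Fin n => Y i ω) (T n fun i : Fin n => Y i ω)}) atTop (𝓝 0) ∧
      TendstoInMeasure P (fun (n : ℕ) ω => T n fun i : Fin n => Y i ω) atTop (fun _ => θ₀) := by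
  obtain ⟨hU, hUΘ, hθ₀U, hpd⟩ := hC2
  obtain ⟨hJ, lam, hlam, hspec⟩ := hC4
  obtain ⟨M, m, hM⟩ := hC5
  have hint : ∀ i, ∀ θ ∈ U, Integrable (fun y => f i y θ ^ (1 + α)) μ := fun i θ hθ =>
    ((hC3 i).2 θ hθ).1
  choose G hG hGae using fun i => exists_goodSet (g := f i) hα (hf i) (hC1 i) hU hUΘ hθ₀U (hpd i)
    (hint i) (hC3 i).1 fun j k l => (hM i j k l).1
  have hE₁ : ∀ i l, ∫ y, pd l (V α μ (f i) y) θ₀ ∂(law μ (f i) θ₀) = 0 := fun i l => by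
    have h3 := (((hC3 i).2 θ₀ hθ₀U).2 l).1
    refine integral_pd_V_eq_zero hα (hf i) (hC1 i) hU hUΘ hθ₀U ?_ (hint i)
      ((hC3 i).1 θ₀ hθ₀U l l l).1 h3.1 h3.2
    filter_upwards [hpd i] with y hy hyX using (hy hyX).hasPds.of_succ.of_succ
  have hind : ∀ (i : ℕ) (F : 𝒴 → ℝ), F =ᵐ[law μ (f i) θ₀] (G i).indicator F := fun i F => by
    filter_upwards [hGae i] with y hy
    rw [Set.indicator_of_mem hy]
  have hYG : ∀ i, ∀ᵐ ω ∂P, Y i ω ∈ G i := fun i =>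
    ae_of_ae_map (hY i).aemeasurable (by rw [hlaw i]; exact hGae i)
  -- The factor `2` places the closed ball of radius `r` inside an open ball contained in `U`.
  obtain ⟨r, hr, hrU⟩ : ∃ r : ℝ, 0 < r ∧ Metric.ball θ₀ (2 * r) ⊆ U := by
    obtain ⟨R, hR, h⟩ := Metric.isOpen_iff.1 hU θ₀ hθ₀U
    exact ⟨R / 2, half_pos hR, by rwa [mul_div_cancel₀ R two_ne_zero]⟩
  have hPsi := isHermitian_Psi hJ
  have hlaw' : (fun i => P.map (Y i)) = fun i => law μ (f i) θ₀ := funext hlaw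
  obtain ⟨T, hT, hTr, hlim⟩ := RenyiPD.exists_consistent_critical (P := P) (Y := Y)
    (v := fun i => V α μ (f i)) (A := Psi α μ f θ₀) (m := ∑ j, ∑ k, ∑ l, m j k l)
    hU hG hr hrU hY hindep hYG
    (fun l => by rw [hlaw']; exact (hC6 l l l).1.congr fun i => hind i _)
    (fun k l => by rw [hlaw']; exact (hC6 k l l).2.1.congr fun i => hind i _)
    (fun i l => by rw [hlaw, ← integral_congr_ae (hind i _)]; exact hE₁ i l)
    hlam
    (fun n => by simpa [Matrix.IsHermitian, Matrix.IsSymm] using hPsi n)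
    (fun n hn h => quadForm_ge_of_spectrum_ge (hPsi n) (hspec n hn) h)
    (fun n k l => by
      -- Symmetry of `Psi`, which is part of positive definiteness of the `J`, exchanges the order
      -- of differentiation in expectation without Schwarz's theorem.
      have hs : Psi α μ f θ₀ n l k = Psi α μ f θ₀ n k l := by simpa using (hPsi n).apply k l
      rw [hs, Psi_apply]
      congr 2
      refine Finset.sum_congr rfl fun i _ => ?_
      rw [hlaw, ← integral_congr_ae (hind i _)])
    (fun i => by
      rw [hlaw]
      exact integrable_finsetSum _ fun j _ => integrable_finsetSum _ fun k _ =>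
        integrable_finsetSum _ fun l _ => (hM i j k l).2.1)
    (fun i => by
      rw [hlaw, integral_finsetSum _ fun j _ => integrable_finsetSum _ fun k _ =>
        integrable_finsetSum _ fun l _ => (hM i j k l).2.1]
      refine Finset.sum_congr rfl fun j _ => ?_
      rw [integral_finsetSum _ fun k _ => integrable_finsetSum _ fun l _ => (hM i j k l).2.1]
      refine Finset.sum_congr rfl fun k _ => ?_
      rw [integral_finsetSum _ fun l _ => (hM i j k l).2.1]
      exact Finset.sum_congr rfl fun l _ => (hM i j k l).2.2)
  have hrU' : Metric.closedBall θ₀ r ⊆ U :=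
    (Metric.closedBall_subset_ball (by linarith)).trans hrU
  refine ⟨T, hT, fun n y => hUΘ (hrU' (hTr n y)), ?_, ?_⟩
  -- Any radius serves here. Existence of the partial derivatives at `T` comes from the almost sure
  -- event that all observations lie in their good sets.
  · refine tendsto_of_tendsto_of_tendsto_of_le_of_le tendsto_const_nhds (hlim 1 one_pos)
      (fun _ => zero_le) fun n => ?_
    refine measure_mono_ae ?_
    filter_upwards [ae_all_iff.2 hYG] with ω hω hbad hgood
    refine hbad fun j => ⟨?_, hgood.1 j⟩
    exact (hasPds_avg hU hG (fun i : Fin n => hω i) j).1 _ (hrU' (hTr n _))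
  · rw [tendstoInMeasure_iff_norm]
    intro ε hε
    -- Convergence in measure concerns distances `≥ ε`, whereas the good event allows equality; `ε /
    -- 2` separates the two.
    refine tendsto_of_tendsto_of_tendsto_of_le_of_le tendsto_const_nhds (hlim (ε / 2) (half_pos hε))
      (fun _ => zero_le) fun n => measure_mono fun ω hω hgood => ?_
    have h1 : ε ≤ ‖(T n fun i : Fin n => Y i ω) - θ₀‖ := hω
    linarith [hgood.2]
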